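/- Setting. Let $N\ge 0$, let $I_1,\dots,I_N$ be copies of a nonzero finite-dimensional Hilbert space and $O_1,\dots,O_N$ copies of another one; write $IO=I_1\otimes\cdots\otimes I_N\otimes O_1\otimes\cdots\otimes O_N$ and $d_O=\dim(O_1\otimes\cdots\otimes O_N)$. Let $\mu$ be a prior probability distribution on $\mathbb R$ with finite first moment, and let $(\mathcal E_\theta)_{\theta\in\mathbb R}$ be a family of quantum channels (completely positive trace-preserving maps) from operators on $I_j$ to operators on $O_j$, depending measurably on $\theta$. Let $C_\theta$ be the Choi operator of $\mathcal E_\theta^{\otimes N}$, where the Choi operator of $\mathcal E$ is $\sum_{x,y}|x\rangle\langle y|\otimes\mathcal E(|x\rangle\langle y|)$, and put $\bar C=\int C_\theta\,d\mu(\theta)$ and $\overline{\theta C}=\int\theta\, C_\theta\,d\mu(\theta)$. Let $H$ be a Hermitian operator on $IO$ with $-(H\bar C+\bar C H)=\overline{\theta C}$ (that is, the derivative of $e^{-H\tau}\bar Ce^{-H\tau}$ at $\tau=0$ is $\overline{\theta C}$), and let $\Phi$ be a matrix with $q$ columns and $\Phi\Phi^\dagger=\bar C$. Below, $^*$ is the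 entrywise complex conjugate and $^\dagger$ the adjoint. Replacement maps. For a subsystem $Q$ of $IO$ put ${}_Q\tilde X=\mathrm{tr}_Q\tilde X\otimes \mathbb I_Q/d_Q$; in subscripts, products denote composition of these maps, sums denote sums of maps, and $1$ is the identity map. Define linear maps on operators on $IO$ by $$\Lambda^{(i)}(\tilde X)={}_{O_1\cdots O_N}\tilde X,\qquad \Lambda^{(ii)}(\tilde X)=\tilde X-\sum_{k=1}^N{}_{(1-O_k)I_{k+1}O_{k+1}\cdots I_NO_N}\tilde X,\qquad \Lambda^{(iv)}(\tilde X)={}_{[1-\prod_j(1-O_j+I_jO_j)+\prod_jI_jO_j]}\tilde X .$$ Strategies. A strategy with finite-dimensional output space $F$ is an operator $X\ge0$ on $IO\otimes F$ such that $\tilde X=\mathrm{tr}_FX$ has the following property. - Type $i$ (parallel): $\tilde X=\rho\otimes\mathbb I_{O_1\cdots O_N}$ for a density operator $\rho$ on $I_1\otimes\cdots\otimes I_N$. - Type $ii$ (sequential): $\mathrm{tr}\tilde X=d_O$ and ${}_{I_{k+1}O_{k+1}\cdots I_NO_N}\tilde X={}_{O_kI_{k+1}O_{k+1}\cdots I_NO_N}\tilde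 X$ for $k=1,\dots,N$. - Type $iv$ (general indefinite causal order): $X\star C$ has trace $1$ for the Choi operator $C$ of $\mathcal M_1\otimes\cdots\otimes\mathcal M_N$, for all channels $\mathcal M_1,\dots,\mathcal M_N$. Here $X\star C=\mathrm{tr}_{IO}[X(C^T\otimes\mathbb I_F)]$ is the link product. Maximal information. A strategy $X$ has the output states $\rho_\theta=X\star C_\theta$; put $\bar\rho=\int\rho_\theta\,d\mu(\theta)$ and $\overline{\theta\rho}=\int\theta\rho_\theta\,d\mu(\theta)$. The information gained is $\mathcal J(X)=\mathrm{tr}(\bar\rho S^2)$, where $S$ is a Hermitian operator with $\overline{\theta\rho}=\tfrac12(\bar\rho S+S\bar\rho)$. Let $\mathcal J^{(k)}_{\max}$ be the supremum of $\mathcal J(X)$ over all strategies $X$ of type $k$, with $F$ of any finite dimension. Statement. For $k=i,ii,iv$, the supremum $\mathcal J^{(k)}_{\max}$ is attained by some strategy of type $k$, and it is the minimum (which is attained) of the semidefinite program $$\min_{h,\lambda,\tilde Y}\ \lambda\quad\text{s.t.}\quad \Lambda^{(k)}(\tilde Y)=0,\qquad \begin{bmatrix}\lambda\,\mathbb I_{IO}/d_O+\tilde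 Y & 2(H^*\Phi^*-i\Phi^*h)\\ 2(H^*\Phi^*-i\Phi^*h)^\dagger & \mathbb I_q\end{bmatrix}\ge0,$$ over real $\lambda$, Hermitian $q\times q$ matrices $h$ and Hermitian operators $\tilde Y$ on $IO$. -/

import Mathlib

open Matrix MeasureTheory
open scoped BigOperators ComplexOrder

/-- Basis labels of `I₁ ⊗ ⋯ ⊗ I_N ⊗ O₁ ⊗ ⋯ ⊗ O_N`, where every input space `I_j` has the basis `a`
and every output space `O_j` has the basis `b`. -/
abbrev IOIndex (N : ℕ) (a b : Type*) : Type _ := (Fin N → a) × (Fin N → b)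

/-- Operators on `I₁ ⊗ ⋯ ⊗ I_N ⊗ O₁ ⊗ ⋯ ⊗ O_N`. -/
abbrev IOMatrix (N : ℕ) (a b : Type*) : Type _ := Matrix (IOIndex N a b) (IOIndex N a b) ℂ

/-! ### Quantum channels and Choi operators -/

section Channels

variable {a b : Type*} [Fintype a] [DecidableEq a] [Fintype b]

/-- Complete positivity: `id_n ⊗ E` maps positive semidefinite matrices to positive semidefinite
matrices, for every `n`. -/
def IsCompletelyPositive (E : Matrix a a ℂ →ₗ[ℂ] Matrix b b ℂ) : Prop :=
  ∀ (n : ℕ) (ρ : Matrix (Fin n × a) (Fin n × a) ℂ), ρ.PosSemidef →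
    (Matrix.of fun s t : Fin n × b =>
      E (Matrix.of fun x y : a => ρ (s.1, x) (t.1, y)) s.2 t.2).PosSemidef

/-- A quantum channel: a completely positive, trace-preserving map. -/
def IsChannel (E : Matrix a a ℂ →ₗ[ℂ] Matrix b b ℂ) : Prop :=
  IsCompletelyPositive E ∧ ∀ ρ : Matrix a a ℂ, (E ρ).trace = ρ.trace

/-- The Choi operator of `M₁ ⊗ ⋯ ⊗ M_N`. The Choi operator of `M_j` is
`∑ₓᵧ |x⟩⟨y| ⊗ M_j(|x⟩⟨y|)`. -/
def choiProd {N : ℕ} (M : Fin N → (Matrix a a ℂ →ₗ[ℂ] Matrix b b ℂ)) : IOMatrix N a b :=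
  Matrix.of fun s t => ∏ j, M j (Matrix.single (s.1 j) (t.1 j) 1) (s.2 j) (t.2 j)

end Channels

/-! ### Tracing out a subsystem and replacing it by the normalized identity -/

section Replace

variable {N : ℕ} {a b : Type*} [Fintype a] [DecidableEq a] [Fintype b] [DecidableEq b]

/-- The map `X ↦ tr_Q X ⊗ 𝟙_Q / d_Q`, where `Q` consists of the `I_j` with `j ∈ P` and the `O_j`
with `j ∈ R`. (The entries of the partial trace, divided by `d_Q`, are averages over the labels of
`Q`; averaging over all labels `u`, `v` and using only those in `Q` gives the same number.) -/
noncomputable def replaceMap (P R : Finset (Fin N)) : IOMatrix N a b →ₗ[ℂ] IOMatrix N a b where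
  toFun X := Matrix.of fun s t =>
    if (∀ j ∈ P, s.1 j = t.1 j) ∧ (∀ j ∈ R, s.2 j = t.2 j) then
      ((Fintype.card (IOIndex N a b) : ℂ))⁻¹ *
        ∑ w : IOIndex N a b,
          X (P.piecewise w.1 s.1, R.piecewise w.2 s.2) (P.piecewise w.1 t.1, R.piecewise w.2 t.2)
    else 0
  map_add' X Y := by
    ext s t
    simp only [Matrix.of_apply, Matrix.add_apply, Finset.sum_add_distrib, mul_add]
    split_ifs <;> simp
  map_smul' c X := by
    ext s t
    simp only [Matrix.of_apply, Matrix.smul_apply, smul_eq_mul, RingHom.id_apply,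
      ← Finset.mul_sum]
    split_ifs <;> ring

end Replace

/-! ### Strategies -/

/-- The three types of strategies: parallel, sequential, general indefinite causal order. -/
inductive StrategyType : Type
  | i
  | ii
  | iv

section Strategies

variable {N : ℕ} {a b : Type*} [Fintype a] [DecidableEq a] [Fintype b] [DecidableEq b]

/-- The positions after the `k`-th one. -/
def later (k : Fin N) : Finset (Fin N) := Finset.univ.filter fun j => k < j

/-- The projection `Λ^{(k)}`:
* `Λ^{(i)} X` traces out and replaces `O₁ ⋯ O_N`;
* `Λ^{(ii)} = id - ∑ₖ P_k`, where `P_k X` is the difference of the replacements at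
  `I_{k+1} O_{k+1} ⋯ I_N O_N` and at `O_k I_{k+1} O_{k+1} ⋯ I_N O_N`;
* `Λ^{(iv)} = id - ∏ⱼ (id - O_j + I_j O_j) + ∏ⱼ I_j O_j`, where a subsystem stands for its
  replacement map and products are compositions. -/
noncomputable def Lam : StrategyType → IOMatrix N a b →ₗ[ℂ] IOMatrix N a b
  | .i => replaceMap ∅ Finset.univ
  | .ii => LinearMap.id -
      ∑ k : Fin N, (replaceMap (later k) (later k) - replaceMap (later k) (insert k (later k)))
  | .iv => LinearMap.id -
      (((List.finRange N).map fun j =>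
        (1 - replaceMap ∅ {j} + replaceMap {j} {j} : Module.End ℂ (IOMatrix N a b))).prod) +
      replaceMap Finset.univ Finset.univ

/-- The link product `X ⋆ C = tr_{IO} [X (Cᵀ ⊗ 𝟙_F)]` of an operator on `IO ⊗ F` and an operator
on `IO`. -/
def linkProd {F : Type*} (X : Matrix (IOIndex N a b × F) (IOIndex N a b × F) ℂ)
    (C : IOMatrix N a b) : Matrix F F ℂ :=
  Matrix.of fun f g => ∑ s, ∑ t, X (s, f) (t, g) * Cᵀ t s

/-- The partial trace `X̃ = tr_F X`. -/
def traceF {F : Type*} [Fintype F] (X : Matrix (IOIndex N a b × F) (IOIndex N a b × F) ℂ) :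
    IOMatrix N a b :=
  Matrix.of fun s t => ∑ f, X (s, f) (t, f)

/-- `X` is (the operator of) a strategy of the given type, with final output space `F`.
* Parallel: `tr_F X = ρ ⊗ 𝟙_O` for a density operator `ρ` on `I₁ ⊗ ⋯ ⊗ I_N`.
* Sequential: `X` is a quantum comb for the order `1 ≺ 2 ≺ ⋯ ≺ N`.
* General: inserting arbitrary channels in the `N` slots always produces a state on `F`. -/
def IsStrategy {F : Type*} [Fintype F] (k : StrategyType)
    (X : Matrix (IOIndex N a b × F) (IOIndex N a b × F) ℂ) : Prop :=
  X.PosSemidef ∧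
    match k with
    | .i => ∃ ρ : Matrix (Fin N → a) (Fin N → a) ℂ, ρ.PosSemidef ∧ ρ.trace = 1 ∧
        traceF X = Matrix.kronecker ρ (1 : Matrix (Fin N → b) (Fin N → b) ℂ)
    | .ii => (traceF X).trace = (Fintype.card (Fin N → b) : ℂ) ∧
        ∀ k : Fin N, replaceMap (later k) (later k) (traceF X) =
          replaceMap (later k) (insert k (later k)) (traceF X)
    | .iv => ∀ M : Fin N → (Matrix a a ℂ →ₗ[ℂ] Matrix b b ℂ), (∀ j, IsChannel (M j)) →
        (linkProd X (choiProd M)).trace = 1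

/-! ### Bayesian estimation of a channel parameter -/

/-- The entrywise integral of a matrix-valued function. -/
noncomputable def meanMatrix {n : Type*} (μ : Measure ℝ) (A : ℝ → Matrix n n ℂ) : Matrix n n ℂ :=
  Matrix.of fun s t => ∫ θ, A θ s t ∂μ

/-- The Choi operator `C_θ` of `N` copies of the channel `E_θ`. -/
def choiN (N : ℕ) (E : ℝ → (Matrix a a ℂ →ₗ[ℂ] Matrix b b ℂ)) (θ : ℝ) : IOMatrix N a b :=
  choiProd fun _ : Fin N => E θ

/-- The mean `C̄ = ∫ C_θ dμ(θ)`. -/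
noncomputable def meanChoi (N : ℕ) (μ : Measure ℝ) (E : ℝ → (Matrix a a ℂ →ₗ[ℂ] Matrix b b ℂ)) :
    IOMatrix N a b :=
  meanMatrix μ (choiN N E)

/-- The first moment `∫ θ C_θ dμ(θ)`. -/
noncomputable def momentChoi (N : ℕ) (μ : Measure ℝ) (E : ℝ → (Matrix a a ℂ →ₗ[ℂ] Matrix b b ℂ)) :
    IOMatrix N a b :=
  meanMatrix μ fun θ => (θ : ℂ) • choiN N E θ

/-- All values of the information `J = tr (ρ̄ S²)` that strategies of type `k` can gain, with an
output space `F` of any finite dimension `d`. Here `ρ_θ = X ⋆ C_θ` is the output state,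
`ρ̄ = ∫ ρ_θ dμ(θ)`, and `S` is Hermitian with `(ρ̄ S + S ρ̄) / 2 = ∫ θ ρ_θ dμ(θ)`. -/
def informationValues (k : StrategyType) (N : ℕ) (μ : Measure ℝ)
    (E : ℝ → (Matrix a a ℂ →ₗ[ℂ] Matrix b b ℂ)) : Set ℝ :=
  {J | ∃ (d : ℕ) (X : Matrix (IOIndex N a b × Fin d) (IOIndex N a b × Fin d) ℂ)
      (S : Matrix (Fin d) (Fin d) ℂ),
    IsStrategy k X ∧ S.IsHermitian ∧
    (1 / 2 : ℂ) • (meanMatrix μ (fun θ => linkProd X (choiN N E θ)) * S +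
        S * meanMatrix μ (fun θ => linkProd X (choiN N E θ))) =
      meanMatrix μ (fun θ => (θ : ℂ) • linkProd X (choiN N E θ)) ∧
    J = ((meanMatrix μ (fun θ => linkProd X (choiN N E θ)) * (S * S)).trace).re}

/-- The maximal information `J_max^{(k)}`. -/
noncomputable def Jmax (k : StrategyType) (N : ℕ) (μ : Measure ℝ)
    (E : ℝ → (Matrix a a ℂ →ₗ[ℂ] Matrix b b ℂ)) : ℝ :=
  sSup (informationValues k N μ E)

/-! ### The dual semidefinite program -/

/-- The matrix `2 (H* Φ* - i Φ* h)`, where `*` is the entrywise complex conjugate. -/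
noncomputable def dualCorner {q : ℕ} (H : IOMatrix N a b) (Φ : Matrix (IOIndex N a b) (Fin q) ℂ)
    (h : Matrix (Fin q) (Fin q) ℂ) : Matrix (IOIndex N a b) (Fin q) ℂ :=
  (2 : ℂ) • (H.map star * Φ.map star - Complex.I • (Φ.map star * h))

/-- `(h, l, Y)` is feasible for the dual semidefinite program. -/
def DualFeasible (k : StrategyType) {q : ℕ} (H : IOMatrix N a b)
    (Φ : Matrix (IOIndex N a b) (Fin q) ℂ)
    (h : Matrix (Fin q) (Fin q) ℂ) (l : ℝ) (Y : IOMatrix N a b) : Prop :=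
  h.IsHermitian ∧ Y.IsHermitian ∧ Lam k Y = 0 ∧
    (Matrix.fromBlocks
      (((l : ℂ) / (Fintype.card (Fin N → b) : ℂ)) • (1 : IOMatrix N a b) + Y)
      (dualCorner H Φ h) (dualCorner H Φ h)ᴴ
      (1 : Matrix (Fin q) (Fin q) ℂ)).PosSemidef

/-- The values of the objective `λ` at the feasible points of the dual semidefinite program. -/
def dualValues (k : StrategyType) {q : ℕ} (H : IOMatrix N a b)
    (Φ : Matrix (IOIndex N a b) (Fin q) ℂ) : Set ℝ :=
  {l | ∃ (h : Matrix (Fin q) (Fin q) ℂ) (Y : IOMatrix N a b), DualFeasible k H Φ h l Y}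

end Strategies

/-! ### Positive semidefinite matrices -/

section MatrixTools

/-! Write C and D for the mean and the first moment of the Choi operators, Ψ for the entrywise
conjugate of Φ, and M for `dualCorner`. Then ΨΨᴴ = Cᵀ, and MΨᴴ + ΨMᴴ = -2Dᵀ whatever the Hermitian h
is (`dualCorner_add`): h parametrises the freedom left in M.

All strategy types are treated together. Each `Lam k` is an idempotent, self-adjoint for tr(XY),
that fixes the identity, and a positive X is a strategy exactly when its partial trace X̃ has trace
d_O and is fixed by `Lam k` (`isStrategy_iff`). Being fixed means being orthogonal to the Hermitian
kernel of `Lam k` (`IsTraceSelfAdjoint.apply_eq_self_iff`), so that kernel supplies the dual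
variable Y. The hard case is indefinite order (`Lam_iv_eq_self_iff`), where Choi operators of
channels must be shown to span all operators whose partial trace over the output is a multiple of
the identity.

Weak duality (`information_le_of_dualFeasible`): for K = M ⊗ 1 + Ψ ⊗ S, expanding tr(X K Kᴴ) ≥ 0
gives J(X) ≤ tr(X̃ M Mᴴ). The Schur complement of the block constraint then bounds this by tr
X̃(λ/d_O + Y) = λ.

Strong duality (`exists_dual_optimum`): since tr Y = 0, the dual minimises tr A over A = r·1 + Y
with A ≥ MMᴴ. A minimum exists by compactness, and Hahn-Banach separation yields a multiplier X ≥ 0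
(`Matrix.exists_saddle_point`). Up to scaling, X is the partial trace of a strategy; complementary
slackness gives tr(X MMᴴ) = λ, and stationarity in h says that ΨᴴXM is Hermitian.

Attainment (`exists_strategy_of_dual_optimum`): purify X = RRᴴ and solve B RᴴΨ = -RᴴM for a
Hermitian B; this is equality in weak duality with S = Bᵀ. Such a B exists by the stationarity
condition together with a kernel inclusion, which comes from ker C ⊆ ker D: a vector killed by the
mean of positive operators is killed by almost all of them (`momentChoi_mul_eq_zero`). -/

open scoped MatrixOrder in
theorem Matrix.PosSemidef.exists_eq_mul_conjTranspose {n : Type*} [Fintype n] [DecidableEq n]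
    {A : Matrix n n ℂ} (hA : A.PosSemidef) : ∃ R : Matrix n n ℂ, A = R * Rᴴ := by
  obtain ⟨B, hB⟩ := CStarAlgebra.nonneg_iff_eq_star_mul_self.mp hA.nonneg
  exact ⟨Bᴴ, by rw [hB, conjTranspose_conjTranspose]; rfl⟩

open scoped MatrixOrder Matrix.Norms.L2Operator in
theorem Matrix.IsHermitian.posSemidef_norm_smul_one_sub {n : Type*} [Fintype n] [DecidableEq n]
    {A : Matrix n n ℂ} (hA : A.IsHermitian) : ((‖A‖ : ℝ) • (1 : Matrix n n ℂ) - A).PosSemidef := by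
  have h := IsSelfAdjoint.le_algebraMap_norm_self (a := A) hA
  rwa [Matrix.le_iff, Algebra.algebraMap_eq_smul_one] at h

theorem Matrix.IsHermitian.exists_posSemidef_smul_one_sub {n : Type*} [Fintype n] [DecidableEq n]
    {A : Matrix n n ℂ} (hA : A.IsHermitian) :
    ∃ c : ℝ, 0 ≤ c ∧ (c • (1 : Matrix n n ℂ) - A).PosSemidef := by
  open scoped Matrix.Norms.L2Operator in
  exact ⟨‖A‖, norm_nonneg _, hA.posSemidef_norm_smul_one_sub⟩

theorem Matrix.PosSemidef.real_smul {n : Type*} [Fintype n] {A : Matrix n n ℂ}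
    (hA : A.PosSemidef) {c : ℝ} (hc : 0 ≤ c) : (c • A).PosSemidef :=
  hA.smul hc

theorem Matrix.posSemidef_mul_conjTranspose_self' {n m : Type*} [Fintype n] [Fintype m]
    (V : Matrix n m ℂ) : (V * Vᴴ).PosSemidef := by
  simpa using Matrix.posSemidef_conjTranspose_mul_self Vᴴ

theorem Matrix.PosSemidef.re_trace_mul_nonneg {n : Type*} [Fintype n] [DecidableEq n]
    {A B : Matrix n n ℂ} (hA : A.PosSemidef) (hB : B.PosSemidef) : 0 ≤ (A * B).trace.re := by
  obtain ⟨R, rfl⟩ := hA.exists_eq_mul_conjTranspose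
  rw [Matrix.mul_assoc, Matrix.trace_mul_comm]
  exact (Complex.le_def.mp (hB.conjTranspose_mul_mul_same R).trace_nonneg).1

theorem Matrix.IsHermitian.trace_mul_im_eq_zero {n : Type*} [Fintype n] {A B : Matrix n n ℂ}
    (hA : A.IsHermitian) (hB : B.IsHermitian) : (A * B).trace.im = 0 := by
  have h : star (A * B).trace = (A * B).trace := by
    rw [← trace_conjTranspose, conjTranspose_mul, hA.eq, hB.eq, trace_mul_comm]
  exact Complex.conj_eq_iff_im.mp h

theorem Matrix.IsHermitian.trace_im_eq_zero {n : Type*} [Fintype n] {A : Matrix n n ℂ}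
    (hA : A.IsHermitian) : A.trace.im = 0 := by
  have h : star A.trace = A.trace := by
    rw [← trace_conjTranspose, hA.eq]
  exact Complex.conj_eq_iff_im.mp h

theorem Matrix.trace_mul_conjTranspose_eq_sum {n m : Type*} [Fintype n] [Fintype m]
    (R : Matrix n m ℂ) : (R * Rᴴ).trace.re = ∑ i, ∑ k, ‖R i k‖ ^ 2 := by
  simp only [trace, diag_apply, mul_apply, conjTranspose_apply, Complex.re_sum]
  refine Finset.sum_congr rfl fun i _ => Finset.sum_congr rfl fun k _ => ?_
  rw [RCLike.star_def, Complex.mul_conj, Complex.normSq_eq_norm_sq, Complex.ofReal_re]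

theorem Matrix.norm_entry_sq_le_re_trace {n m : Type*} [Fintype n] [Fintype m]
    (R : Matrix n m ℂ) (i : n) (j : m) : ‖R i j‖ ^ 2 ≤ (R * Rᴴ).trace.re := by
  rw [trace_mul_conjTranspose_eq_sum]
  calc ‖R i j‖ ^ 2 ≤ ∑ k, ‖R i k‖ ^ 2 :=
        Finset.single_le_sum (f := fun k => ‖R i k‖ ^ 2) (fun _ _ => by positivity)
          (Finset.mem_univ j)
    _ ≤ _ := Finset.single_le_sum (f := fun i => ∑ k, ‖R i k‖ ^ 2)
          (fun _ _ => by positivity) (Finset.mem_univ i)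

/-- With A = RRᴴ an entry is an inner product of two rows of R, which is at most the mean of their
squared lengths. This supplies the boundedness for the compactness argument and for the
integrability of Choi operators. -/
theorem Matrix.PosSemidef.norm_entry_le_re_trace {n : Type*} [Fintype n]
    {A : Matrix n n ℂ} (hA : A.PosSemidef) (i j : n) : ‖A i j‖ ≤ A.trace.re := by
  classical
  obtain ⟨R, rfl⟩ := hA.exists_eq_mul_conjTranspose
  have h : ∀ i, ∑ k, ‖R i k‖ ^ 2 ≤ (R * Rᴴ).trace.re := fun i => by
    rw [trace_mul_conjTranspose_eq_sum]
    exact Finset.single_le_sum (f := fun i => ∑ k, ‖R i k‖ ^ 2)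
          (fun _ _ => by positivity) (Finset.mem_univ i)
  calc ‖(R * Rᴴ) i j‖ ≤ ∑ k, ‖R i k‖ * ‖R j k‖ := by
        rw [mul_apply]
        refine (norm_sum_le _ _).trans (le_of_eq ?_)
        simp
    _ ≤ ∑ k, (‖R i k‖ ^ 2 + ‖R j k‖ ^ 2) / 2 :=
        Finset.sum_le_sum fun k _ => by nlinarith [sq_nonneg (‖R i k‖ - ‖R j k‖)]
    _ = ((∑ k, ‖R i k‖ ^ 2) + ∑ k, ‖R j k‖ ^ 2) / 2 := by
        rw [← Finset.sum_div, Finset.sum_add_distrib]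
    _ ≤ _ := by linarith [h i, h j]

theorem Matrix.IsHermitian.eq_zero_of_trace_mul_self {n : Type*} [Fintype n]
    {A : Matrix n n ℂ} (hA : A.IsHermitian) (h : (A * A).trace.re = 0) : A = 0 := by
  have him := hA.trace_mul_im_eq_zero hA
  have h0 : (Aᴴ * A).trace = 0 := by rw [hA.eq]; exact Complex.ext h him
  exact trace_conjTranspose_mul_self_eq_zero_iff.mp h0

/-- A Hermitian matrix has a Hermitian pseudoinverse. -/
theorem Matrix.IsHermitian.exists_pseudoinverse {n : Type*} [Fintype n] [DecidableEq n]
    {A : Matrix n n ℂ} (hA : A.IsHermitian) :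
    ∃ S : Matrix n n ℂ, S.IsHermitian ∧ A * S * A = A := by
  set φ := Unitary.conjStarAlgAut ℂ (Matrix n n ℂ) hA.eigenvectorUnitary
  set D : Matrix n n ℂ := diagonal (RCLike.ofReal ∘ hA.eigenvalues)
  set D' : Matrix n n ℂ := diagonal fun i => ((hA.eigenvalues i)⁻¹ : ℂ)
  have hAD : A = φ D := hA.spectral_theorem
  have h2 : D * D' * D = D := by
    simp only [D, D', diagonal_mul_diagonal]; congr 1; ext i
    simp only [Function.comp]
    exact mul_inv_mul_cancel _
  have h3 : star D' = D' := by
    rw [star_eq_conjTranspose]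
    simp only [D', diagonal_conjTranspose]; congr 1; ext i; simp
  refine ⟨φ D', ?_, ?_⟩
  · change star (φ D') = φ D'
    rw [← map_star, h3]
  · rw [hAD, ← map_mul, ← map_mul, h2]

/-- GᴴG and G have the same kernel, so the leading Gᴴ can be cancelled. Hence G S Gᴴ acts as the
identity on the range of G. -/
theorem Matrix.mul_eq_self_of_pseudoinverse {m n : Type*} [Fintype n] [DecidableEq n] [Fintype m]
    {G : Matrix m n ℂ} {S : Matrix n n ℂ} (hS : Gᴴ * G * S * (Gᴴ * G) = Gᴴ * G) :
    G * S * (Gᴴ * G) = G := by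
  have h : Gᴴ * (G * (1 - S * (Gᴴ * G))) = 0 := by
    rw [← Matrix.mul_assoc, Matrix.mul_sub, Matrix.mul_one, ← Matrix.mul_assoc, hS, sub_self]
  have h2 : G * (1 - S * (Gᴴ * G)) = 0 := (conjTranspose_mul_self_mul_eq_zero G _).mp
    (by rw [Matrix.mul_assoc]; exact h)
  rw [Matrix.mul_sub, Matrix.mul_one, sub_eq_zero, ← Matrix.mul_assoc] at h2
  exact h2.symm

/-- The equation `B G = K` has a Hermitian solution `B` as soon as `Gᴴ K` is Hermitian and
`ker G ⊆ ker K`. -/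
theorem Matrix.exists_isHermitian_mul_eq {m n : Type*} [Fintype m] [Fintype n] [DecidableEq n]
    (G K : Matrix m n ℂ) (h : (Gᴴ * K).IsHermitian)
    (hker : ∀ T : Matrix n n ℂ, G * T = 0 → K * T = 0) :
    ∃ B : Matrix m m ℂ, B.IsHermitian ∧ B * G = K := by
  have hGG : (Gᴴ * G).IsHermitian := isHermitian_conjTranspose_mul_self G
  obtain ⟨S, hS, hSG⟩ := hGG.exists_pseudoinverse
  have hG := mul_eq_self_of_pseudoinverse hSG
  -- P is the orthogonal projection onto the range of G, and L is one solution of L G = K, generally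
  -- not Hermitian.
  set P := G * S * Gᴴ with hP
  set L := K * S * Gᴴ with hL
  have hPH : Pᴴ = P := by simp [hP, hS.eq, Matrix.mul_assoc]
  have hPG : P * G = G := by rw [hP, Matrix.mul_assoc]; exact hG
  have hLG : L * G = K := by
    have h0 : K * (1 - S * (Gᴴ * G)) = 0 := hker _ (by
      rw [Matrix.mul_sub, Matrix.mul_one, ← Matrix.mul_assoc, hG, sub_self])
    rw [Matrix.mul_sub, Matrix.mul_one, sub_eq_zero] at h0
    rw [hL, Matrix.mul_assoc, Matrix.mul_assoc, ← h0]
  have hK : Gᴴ * K = Kᴴ * G := by rw [← h.eq]; simp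
  have hPLP : P * Lᴴ * P = P * L * P := by
    have e1 : P * L * P = G * S * (Gᴴ * K) * S * Gᴴ := by
      calc P * L * P = G * S * Gᴴ * (L * G) * S * Gᴴ := by simp only [hP, Matrix.mul_assoc]
        _ = _ := by rw [hLG]; simp only [Matrix.mul_assoc]
    have e2 : P * Lᴴ * P = (P * L * P)ᴴ := by simp [hPH, Matrix.mul_assoc]
    rw [e2, e1]
    simp only [conjTranspose_mul, conjTranspose_conjTranspose, hS.eq, ← Matrix.mul_assoc]
    rw [Matrix.mul_assoc (G * S) Gᴴ K, hK]
    simp only [Matrix.mul_assoc]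
  -- Symmetrise L without changing its action on the range of G. The subtracted corner is Hermitian
  -- because PLP = PLᴴP, which is where the hypothesis on GᴴK enters.
  refine ⟨L * P + P * Lᴴ - P * Lᴴ * P, ?_, ?_⟩
  · change (L * P + P * Lᴴ - P * Lᴴ * P)ᴴ = _
    simp only [conjTranspose_sub, conjTranspose_add, conjTranspose_mul, conjTranspose_conjTranspose,
      hPH]
    rw [hPLP, Matrix.mul_assoc P L P, add_comm]
  · rw [Matrix.sub_mul, Matrix.add_mul, Matrix.mul_assoc L, hPG, Matrix.mul_assoc (P * Lᴴ), hPG,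
      hLG]
    simp

/-- Schur complement of an identity block. -/
theorem Matrix.posSemidef_fromBlocks_one_iff {m n : Type*} [Fintype m] [Fintype n] [DecidableEq n]
    (A : Matrix m m ℂ) (M : Matrix m n ℂ) :
    (fromBlocks A M Mᴴ (1 : Matrix n n ℂ)).PosSemidef ↔ (A - M * Mᴴ).PosSemidef := by
  have : Invertible (1 : Matrix n n ℂ) := invertibleOne
  simpa using Matrix.PosDef.fromBlocks₂₂ A M (Matrix.PosDef.one (n := n) (R := ℂ))

end MatrixTools

/-! ### A conic saddle point theorem -/

section Saddle

variable {n : Type*} [Fintype n]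

theorem Matrix.isClosed_setOf_posSemidef : IsClosed {A : Matrix n n ℂ | A.PosSemidef} := by
  have h : {A : Matrix n n ℂ | A.PosSemidef} =
      {A | Aᴴ = A} ∩ ⋂ x : n → ℂ, {A | 0 ≤ star x ⬝ᵥ A *ᵥ x} := by
    ext A
    simp [posSemidef_iff_dotProduct_mulVec, IsHermitian]
  rw [h]
  refine (isClosed_eq (by fun_prop) continuous_id).inter (isClosed_iInter fun x => ?_)
  exact isClosed_le continuous_const
    (continuous_const.dotProduct (continuous_id.matrix_mulVec continuous_const))

/-- A linear functional that is invariant under the adjoint is given by a Hermitian matrix. -/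
theorem Matrix.exists_isHermitian_re_trace_mul_eq [DecidableEq n] (g : Matrix n n ℂ →ₗ[ℝ] ℝ)
    (hg : ∀ A, g Aᴴ = g A) :
    ∃ X : Matrix n n ℂ, X.IsHermitian ∧ ∀ A, g A = (X * A).trace.re := by
  -- The real and imaginary parts of an entry are forced by testing on a matrix unit and on
  -- `Complex.I` times it.
  set X : Matrix n n ℂ := Matrix.of fun i j =>
    (g (single j i 1) : ℂ) - Complex.I * (g (single j i Complex.I) : ℂ) with hX
  refine ⟨X, ?_, fun A => ?_⟩
  · ext i j
    have h1 : g (single i j 1) = g (single j i 1) := by rw [← hg, conjTranspose_single]; simp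
    have h2 : g (single i j Complex.I) = - g (single j i Complex.I) := by
      rw [← hg, conjTranspose_single, ← map_neg]
      congr 1
      ext k l
      simp [single_apply, apply_ite]
    simp [hX, h1, h2, sub_eq_add_neg]
  · set f : Matrix n n ℂ →ₗ[ℝ] ℝ :=
      Complex.reLm ∘ₗ (traceLinearMap n ℝ ℂ) ∘ₗ (LinearMap.mulLeft ℝ X) with hf
    change g A = f A
    induction A using Matrix.induction_on' with
    | h_zero => simp
    | h_add p q hp hq => rw [map_add, map_add, hp, hq]
    | h_std_basis i j x =>
      have hx : single i j x = x.re • single i j (1 : ℂ) + x.im • single i j Complex.I := by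
        rw [smul_single, smul_single, ← single_add]
        congr 1
        simp [Complex.re_add_im]
      have key : ∀ y : ℂ, f (single i j y) = (X j i * y).re := fun y => by
        simp only [hf, LinearMap.comp_apply, LinearMap.mulLeft_apply, traceLinearMap_apply]
        rw [trace_mul_single]
        simp
      rw [key, hx, map_add, map_smul, map_smul]
      simp [hX]
      ring

/-- Matrices whose Hermitian part is positive definite. -/
def Matrix.posDefPart (n : Type*) [Fintype n] [DecidableEq n] : Set (Matrix n n ℂ) :=
  {A | ∃ ε : ℝ, 0 < ε ∧ (A + Aᴴ - ε • (1 : Matrix n n ℂ)).PosSemidef}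

theorem Matrix.convex_posDefPart [DecidableEq n] : Convex ℝ (posDefPart n) := by
  rintro A ⟨ε, hε, hA⟩ B ⟨δ, hδ, hB⟩ s t hs ht hst
  refine ⟨s * ε + t * δ, ?_, ?_⟩
  · rcases hs.eq_or_lt with rfl | hs'
    · have : t = 1 := by linarith
      subst this; simpa using hδ
    · have := mul_pos hs' hε
      have := mul_nonneg ht hδ.le
      linarith
  · convert (hA.real_smul hs).add (hB.real_smul ht) using 1
    simp only [conjTranspose_add, conjTranspose_smul, star_trivial]
    module

theorem Matrix.isOpen_posDefPart [DecidableEq n] : IsOpen (posDefPart n) := by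
  open scoped Matrix.Norms.L2Operator in
  rw [Metric.isOpen_iff]
  rintro A ⟨ε, hε, hA⟩
  -- Moving A by less than ε/4 moves A + Aᴴ by at most ε/2, so the margin ε/2 survives.
  refine ⟨ε / 4, by positivity, fun B hB => ⟨ε / 2, by positivity, ?_⟩⟩
  have hD : ‖A - B‖ < ε / 4 := by rwa [← dist_eq_norm, dist_comm]
  set D := A - B + (A - B)ᴴ with hDdef
  have hDH : D.IsHermitian := isHermitian_add_transpose_self _
  have hDn : ‖D‖ ≤ ε / 2 := by
    refine (norm_add_le _ _).trans ?_
    rw [l2_opNorm_conjTranspose]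
    linarith
  have h := (hA.add hDH.posSemidef_norm_smul_one_sub).add
    ((PosSemidef.one (n := n) (R := ℂ)).real_smul (sub_nonneg.mpr hDn))
  convert h using 1
  simp only [hDdef, conjTranspose_sub]
  module

theorem Matrix.smul_mem_posDefPart [DecidableEq n] {A : Matrix n n ℂ} (hA : A ∈ posDefPart n)
    {c : ℝ} (hc : 0 < c) : c • A ∈ posDefPart n := by
  obtain ⟨ε, hε, h⟩ := hA
  refine ⟨c * ε, by positivity, ?_⟩
  convert h.real_smul hc.le using 1
  simp only [conjTranspose_smul, star_trivial]
  module

theorem Matrix.PosSemidef.add_smul_one_mem_posDefPart [DecidableEq n] {A : Matrix n n ℂ}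
    (hA : A.PosSemidef) {ε : ℝ} (hε : 0 < ε) : A + ε • (1 : Matrix n n ℂ) ∈ posDefPart n := by
  refine ⟨ε, hε, ?_⟩
  convert (hA.add hA).add ((PosSemidef.one (n := n) (R := ℂ)).real_smul hε.le) using 1
  simp only [conjTranspose_add, conjTranspose_smul, star_trivial, hA.isHermitian.eq,
    conjTranspose_one]
  module

open scoped Matrix.Norms.Elementwise in
/-- The minimum of `tr A` subject to `A ≥ W Wᴴ`, with `A` in a subspace and `W` in an affine
space, is attained. -/
theorem Matrix.exists_isMin_trace [DecidableEq n] {q : Type*} [Fintype q]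
    (𝒜 : Submodule ℝ (Matrix n n ℂ)) (h1 : 1 ∈ 𝒜)
    (W₀ : Matrix n q ℂ) (𝒱 : Submodule ℝ (Matrix n q ℂ)) :
    ∃ A ∈ 𝒜, ∃ V ∈ 𝒱, (A - (W₀ + V) * (W₀ + V)ᴴ).PosSemidef ∧
      ∀ A' ∈ 𝒜, ∀ V' ∈ 𝒱, (A' - (W₀ + V') * (W₀ + V')ᴴ).PosSemidef →
        A.trace.re ≤ A'.trace.re := by
  -- The point A = c·1, V = 0 is feasible; its trace t cuts the feasible set down to a compact set T
  -- without losing the minimum.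
  obtain ⟨c, -, hc⟩ := (posSemidef_mul_conjTranspose_self' W₀).isHermitian
    |>.exists_posSemidef_smul_one_sub
  set t := (c • (1 : Matrix n n ℂ)).trace.re with ht
  set T : Set (Matrix n n ℂ × Matrix n q ℂ) :=
    {p | p.1 ∈ 𝒜 ∧ p.2 ∈ 𝒱 ∧ (p.1 - (W₀ + p.2) * (W₀ + p.2)ᴴ).PosSemidef ∧ p.1.trace.re ≤ t}
    with hT
  have hclosed : IsClosed T := by
    refine IsClosed.inter (𝒜.closed_of_finiteDimensional.preimage continuous_fst) <|
      IsClosed.inter (𝒱.closed_of_finiteDimensional.preimage continuous_snd) <|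
      IsClosed.inter (isClosed_setOf_posSemidef.preimage ?_)
        (show IsClosed {p : Matrix n n ℂ × Matrix n q ℂ | p.1.trace.re ≤ t} from
          isClosed_le (Complex.continuous_re.comp continuous_fst.matrix_trace) continuous_const)
    fun_prop
  -- On T both A and W Wᴴ are positive with trace at most t, which bounds A and W = W₀ + V
  -- entrywise. The variable is V itself, so a parametrisation of V need not be bounded.
  have hbdd : Bornology.IsBounded T := by
    refine (Metric.isBounded_closedBall (x := ((0, -W₀) : Matrix n n ℂ × Matrix n q ℂ))
      (r := t + 1)).subset ?_
    rintro ⟨A, V⟩ ⟨-, -, hp, htr⟩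
    have hW := posSemidef_mul_conjTranspose_self' (W₀ + V)
    have hA : A.PosSemidef := by simpa using hp.add hW
    have hle : ((W₀ + V) * (W₀ + V)ᴴ).trace.re ≤ A.trace.re := by
      have := (Complex.le_def.mp hp.trace_nonneg).1
      rw [trace_sub, Complex.sub_re, Complex.zero_re] at this
      linarith
    have ht0 : 0 ≤ t := ((Complex.le_def.mp hA.trace_nonneg).1).trans htr
    rw [mem_closedBall_iff_norm, Prod.norm_def]
    refine max_le ?_ ?_
    · rw [Matrix.norm_le_iff (by linarith)]
      intro i j
      simpa using (hA.norm_entry_le_re_trace i j).trans (htr.trans (by linarith))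
    · rw [Matrix.norm_le_iff (by linarith)]
      intro i j
      have h2 := (norm_entry_sq_le_re_trace (W₀ + V) i j).trans (hle.trans htr)
      have h3 : (V - -W₀) i j = (W₀ + V) i j := by simp [add_comm]
      change ‖(V - -W₀) i j‖ ≤ _
      rw [h3]
      nlinarith [sq_nonneg (‖(W₀ + V) i j‖ - 1), norm_nonneg ((W₀ + V) i j)]
  have hmem : ((c • 1, 0) : Matrix n n ℂ × Matrix n q ℂ) ∈ T :=
    ⟨𝒜.smul_mem _ h1, 𝒱.zero_mem, by simpa using hc, le_rfl⟩
  obtain ⟨⟨A, V⟩, ⟨hA, hV, hp, htr⟩, hmin⟩ :=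
    (Metric.isCompact_of_isClosed_isBounded hclosed hbdd).exists_isMinOn ⟨_, hmem⟩
    (f := fun p => p.1.trace.re)
    (Complex.continuous_re.comp continuous_fst.matrix_trace).continuousOn
  refine ⟨A, hA, V, hV, hp, fun A' hA' V' hV' hp' => ?_⟩
  rcases le_total A'.trace.re t with h | h
  · exact hmin (a := (A', V')) ⟨hA', hV', hp', h⟩
  · exact htr.trans h

/-- Separation of the positive cone from a subspace `L` through a boundary point `Z`. -/
theorem Matrix.exists_multiplier [DecidableEq n] (L : Submodule ℝ (Matrix n n ℂ × ℝ))
    (hL : ∀ p ∈ L, p.1.IsHermitian) {Z : Matrix n n ℂ} (hZ : Z.PosSemidef) {r₁ : ℝ}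
    (h1 : ((1, r₁) : Matrix n n ℂ × ℝ) ∈ L)
    (hopt : ∀ p ∈ L, Z + p.1 ∈ posDefPart n → 0 ≤ p.2) :
    ∃ X : Matrix n n ℂ, X.PosSemidef ∧ (∀ p ∈ L, (X * p.1).trace.re = p.2) ∧
      (X * Z).trace.re = 0 := by
  have aux₁ : ∀ x y : ℝ, (∀ ε > 0, x + ε * y ≤ 0) → x ≤ 0 := fun x y h => by
    by_contra! hx
    have h2 := h (x / (2 * (|y| + 1))) (by positivity)
    have h3 : x / (2 * (|y| + 1)) * (|y| + 1) = x / 2 := by field_simp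
    have h4 : 0 < x / (2 * (|y| + 1)) := by positivity
    nlinarith [neg_abs_le y]
  -- By optimality, no direction in L makes the slack strictly positive while decreasing the
  -- objective. Requiring positivity only of the Hermitian part makes the cone open in the space of
  -- all matrices.
  have hdisj : Disjoint (posDefPart n ×ˢ Set.Iio (0 : ℝ))
      ((fun x => ((Z, 0) : Matrix n n ℂ × ℝ) + x) '' (L : Set (Matrix n n ℂ × ℝ))) := by
    rw [Set.disjoint_left]
    rintro _ ⟨hpos, hneg⟩ ⟨p, hp, rfl⟩
    have h := hopt p hp hpos
    have h' : (0 : ℝ) + p.2 < 0 := hneg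
    linarith
  have hc₁ : Convex ℝ (posDefPart n ×ˢ Set.Iio (0 : ℝ)) :=
    convex_posDefPart.prod (convex_Iio (0 : ℝ))
  have ho : IsOpen (posDefPart n ×ˢ Set.Iio (0 : ℝ)) := isOpen_posDefPart.prod isOpen_Iio
  have hc₂ : Convex ℝ ((fun x => ((Z, 0) : Matrix n n ℂ × ℝ) + x) ''
      (L : Set (Matrix n n ℂ × ℝ))) := L.convex.translate ((Z, 0) : Matrix n n ℂ × ℝ)
  obtain ⟨f, u, hfs, hft⟩ := geometric_hahn_banach_open hc₁ ho hc₂ hdisj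
  set τ := f (0, 1) with hτ
  have hf : ∀ A r, f (A, r) = f (A, 0) + r * τ := fun A r => by
    rw [hτ, ← smul_eq_mul, ← map_smul, ← map_add]
    simp
  have hs0 : ∀ A ∈ posDefPart n, ∀ r < 0, f (A, 0) + r * τ ≤ 0 := by
    intro A hA r hr
    rw [← hf]
    by_contra! hpos
    have hk : 0 < (|u| + 1) / f (A, r) := by positivity
    have h := hfs (((|u| + 1) / f (A, r)) • (A, r))
      ⟨smul_mem_posDefPart hA hk, by simpa using mul_neg_of_pos_of_neg hk hr⟩
    rw [map_smul, smul_eq_mul, div_mul_cancel₀ _ hpos.ne'] at h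
    linarith [le_abs_self u]
  have hone : (1 : Matrix n n ℂ) ∈ posDefPart n := by
    simpa using (PosSemidef.zero (n := n) (R := ℂ)).add_smul_one_mem_posDefPart one_pos
  have hf1 : f (1, 0) + (-1) * τ < u := by
    rw [← hf]; exact hfs _ ⟨hone, by simp⟩
  -- The open set is a cone, so a negative bound u would be violated by shrinking one of its points
  -- towards 0.
  have hu : 0 ≤ u := by
    by_contra! hu
    set a := f (1, -1) with ha
    have ha' : a < u := hfs _ ⟨hone, by simp⟩
    have hk : 0 < u / (2 * a) := div_pos_of_neg_of_neg hu (by linarith)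
    have h := hfs ((u / (2 * a)) • ((1, -1) : Matrix n n ℂ × ℝ))
      ⟨smul_mem_posDefPart hone hk, by simpa using hk⟩
    rw [map_smul, smul_eq_mul, ← ha] at h
    have : u / (2 * a) * a = u / 2 := by
      have : a ≠ 0 := by linarith
      field_simp
    linarith
  have hpd : ∀ A ∈ posDefPart n, f (A, 0) ≤ 0 := fun A hA =>
    aux₁ _ (-τ) fun ε hε => by
      have := hs0 A hA (-ε) (by linarith)
      linarith
  have hpsd : ∀ A : Matrix n n ℂ, A.PosSemidef → f (A, 0) ≤ 0 := fun A hA =>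
    aux₁ _ (f (1, 0)) fun ε hε => by
      have := hpd _ (hA.add_smul_one_mem_posDefPart hε)
      rw [← smul_eq_mul, ← map_smul, ← map_add]
      simpa using this
  have hfL : ∀ p ∈ L, ∀ c : ℝ, u ≤ f (Z, 0) + c * f p := fun p hp c => by
    rw [← smul_eq_mul, ← map_smul, ← map_add]
    exact hft _ ⟨c • p, L.smul_mem c hp, rfl⟩
  have hZ0 : f (Z, 0) = 0 := by
    have := hfL 0 L.zero_mem 0
    linarith [hpsd Z hZ]
  have hL0 : ∀ p ∈ L, f p = 0 := fun p hp => by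
    have h2 := hfL p hp 1
    have h3 := hfL p hp (-1)
    linarith
  -- The separating functional is not vertical: if τ = 0, then (1, r₁) ∈ L forces f(1, 0) = 0,
  -- although f < u ≤ 0 on the open cone. This is the role of Slater's condition.
  have hτ0 : 0 < τ := by
    have h2 : 0 ≤ τ := by
      have := aux₁ (-τ) (f (1, 0)) fun ε hε => by
        have := hs0 (ε • 1) (smul_mem_posDefPart hone hε) (-1) (by norm_num)
        have e : f (ε • (1 : Matrix n n ℂ), (0 : ℝ)) = ε * f (1, 0) := by
          rw [← smul_eq_mul, ← map_smul]; simp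
        linarith
      linarith
    rcases h2.eq_or_lt with h0 | h0
    · have h3 := hL0 _ h1
      rw [hf] at h3
      have h4 := hfL 0 L.zero_mem 0
      rw [← h0] at h3 hf1
      linarith
    · exact h0
  -- Only Hermitian arguments matter, so f is symmetrised to be represented by a Hermitian matrix;
  -- division by -τ normalises the objective's coefficient and makes the functional nonnegative on
  -- the positive cone.
  set g : Matrix n n ℂ →ₗ[ℝ] ℝ :=
    { toFun := fun A => -(f (A + Aᴴ, 0) / (2 * τ))
      map_add' := fun A B => by
        have : ((A + B + (A + B)ᴴ, 0) : Matrix n n ℂ × ℝ) = (A + Aᴴ, 0) + (B + Bᴴ, 0) := by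
          ext1
          · simp only [Prod.mk_add_mk, conjTranspose_add]; abel
          · simp
        rw [this, map_add]; ring
      map_smul' := fun c A => by
        have : ((c • A + (c • A)ᴴ, 0) : Matrix n n ℂ × ℝ) = c • (A + Aᴴ, 0) := by
          simp
        rw [this, map_smul]; simp; ring } with hg
  have hgH : ∀ A : Matrix n n ℂ, A.IsHermitian → g A = -(f (A, 0) / τ) := fun A hA => by
    have : ((A + Aᴴ, 0) : Matrix n n ℂ × ℝ) = (2 : ℝ) • (A, 0) := by
      rw [hA.eq]; simp [two_smul]
    change -(f (A + Aᴴ, 0) / (2 * τ)) = _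
    rw [this, map_smul]
    simp only [smul_eq_mul]
    field_simp
  obtain ⟨X, hX, hgX⟩ := exists_isHermitian_re_trace_mul_eq g (fun A => by
    change -(f (Aᴴ + Aᴴᴴ, 0) / (2 * τ)) = -(f (A + Aᴴ, 0) / (2 * τ))
    rw [conjTranspose_conjTranspose, add_comm])
  refine ⟨X, ?_, fun p hp => ?_, ?_⟩
  · rw [posSemidef_iff_dotProduct_mulVec]
    refine ⟨hX, fun x => ?_⟩
    have h2 : star x ⬝ᵥ X *ᵥ x = (X * vecMulVec x (star x)).trace := by
      rw [mul_vecMulVec, trace_vecMulVec, dotProduct_comm]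
    have h3 := posSemidef_vecMulVec_self_star x
    rw [h2, Complex.le_def]
    refine ⟨?_, (hX.trace_mul_im_eq_zero h3.isHermitian).symm⟩
    rw [← hgX, hgH _ h3.isHermitian, Complex.zero_re, neg_nonneg]
    exact div_nonpos_of_nonpos_of_nonneg (hpsd _ h3) hτ0.le
  · have h2 := hL0 p hp
    rw [← Prod.mk.eta (p := p), hf] at h2
    rw [← hgX, hgH _ (hL p hp)]
    field_simp
    linarith
  · rw [← hgX, hgH _ hZ.isHermitian, hZ0]
    simp

/-- First-order optimality condition at a minimum of `tr A` subject to `A ≥ W Wᴴ`. -/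
theorem Matrix.re_trace_nonneg_of_isMin [DecidableEq n] {q : Type*} [Fintype q]
    {A A' : Matrix n n ℂ} {W V' : Matrix n q ℂ} (hZ : (A - W * Wᴴ).PosSemidef)
    (hA' : A'.IsHermitian)
    (hmin : ∀ δ : ℝ, (A + δ • A' - (W + δ • V') * (W + δ • V')ᴴ).PosSemidef →
      A.trace.re ≤ (A + δ • A').trace.re)
    (hpos : A - W * Wᴴ + (A' - (W * V'ᴴ + V' * Wᴴ)) ∈ posDefPart n) : 0 ≤ A'.trace.re := by
  obtain ⟨ε, hε, hpos⟩ := hpos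
  obtain ⟨c, hc0, hc⟩ := (posSemidef_mul_conjTranspose_self' V').isHermitian
    |>.exists_posSemidef_smul_one_sub
  have hDH : (A' - (W * V'ᴴ + V' * Wᴴ))ᴴ = A' - (W * V'ᴴ + V' * Wᴴ) := by
    simp [hA'.eq, add_comm]
  rw [conjTranspose_add, hDH, hZ.isHermitian.eq] at hpos
  -- Small enough that the second-order loss δ²V'V'ᴴ ≤ δ²c is covered by the first-order gain δε/2.
  set δ := min 1 (ε / (2 * (c + 1))) with hδ
  have hδ0 : 0 < δ := lt_min one_pos (by positivity)
  have hδ1 : δ ≤ 1 := min_le_left _ _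
  have hδc : δ * c ≤ ε / 2 := by
    have h2 : δ ≤ ε / (2 * (c + 1)) := min_le_right _ _
    rw [le_div_iff₀ (by positivity)] at h2
    nlinarith
  have key := hmin δ (by
    -- With Z the current slack and D its linearised change, the new slack is (1 - δ)Z + δ(Z + D) -
    -- δ²V'V'ᴴ. The four summands certify its positivity.
    have e := (((hZ.real_smul (sub_nonneg.mpr hδ1)).add
      (hpos.real_smul (show 0 ≤ δ / 2 by positivity))).add
      (hc.real_smul (sq_nonneg δ))).add ((PosSemidef.one (n := n) (R := ℂ)).real_smul
        (show 0 ≤ δ * (ε / 2 - δ * c) from mul_nonneg hδ0.le (sub_nonneg.mpr hδc)))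
    convert e using 1
    rw [conjTranspose_add, conjTranspose_smul, star_trivial,
      Matrix.add_mul, Matrix.mul_add, Matrix.mul_add, Matrix.mul_smul, Matrix.smul_mul,
      Matrix.smul_mul, Matrix.mul_smul]
    module)
  rw [trace_add, trace_smul, Complex.add_re, Complex.smul_re, smul_eq_mul] at key
  exact nonneg_of_mul_nonneg_right (by linarith) hδ0

/-- The minimum of `tr A` subject to `A ≥ W Wᴴ` comes with an optimal multiplier `X`. -/
theorem Matrix.exists_saddle_point [DecidableEq n] {q : Type*} [Fintype q]
    (𝒜 : Submodule ℝ (Matrix n n ℂ)) (h𝒜 : ∀ A ∈ 𝒜, A.IsHermitian) (h1 : 1 ∈ 𝒜)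
    (W₀ : Matrix n q ℂ) (𝒱 : Submodule ℝ (Matrix n q ℂ)) :
    ∃ A ∈ 𝒜, ∃ V ∈ 𝒱, ∃ X : Matrix n n ℂ, X.PosSemidef ∧
      (A - (W₀ + V) * (W₀ + V)ᴴ).PosSemidef ∧
      (∀ A' ∈ 𝒜, (X * A').trace.re = A'.trace.re) ∧
      (X * (A - (W₀ + V) * (W₀ + V)ᴴ)).trace.re = 0 ∧
      ∀ V' ∈ 𝒱, ((W₀ + V)ᴴ * X * V').trace.re = 0 := by
  obtain ⟨A, hA, V, hV, hZ, hmin⟩ := exists_isMin_trace 𝒜 h1 W₀ 𝒱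
  set W := W₀ + V with hW
  -- The derivative of the pair (slack A - WWᴴ, objective tr A) at the minimiser.
  set ℓ : Matrix n n ℂ × Matrix n q ℂ →ₗ[ℝ] Matrix n n ℂ × ℝ :=
    { toFun := fun p => (p.1 - (W * p.2ᴴ + p.2 * Wᴴ), p.1.trace.re)
      map_add' := fun p r => by
        ext1
        · simp only [Prod.fst_add, Prod.snd_add, conjTranspose_add, Matrix.mul_add,
            Matrix.add_mul]
          abel
        · simp
      map_smul' := fun c p => by
        ext1
        · simp [smul_sub, smul_add]
        · simp } with hℓ
  obtain ⟨X, hX, hXL, hXZ⟩ := exists_multiplier ((𝒜.prod 𝒱).map ℓ) (Z := A - W * Wᴴ)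
    (r₁ := (1 : Matrix n n ℂ).trace.re) (by
      rintro _ ⟨p, ⟨hp, -⟩, rfl⟩
      change (p.1 - (W * p.2ᴴ + p.2 * Wᴴ))ᴴ = _
      simp [(h𝒜 _ hp).eq, add_comm, hℓ]) hZ
    ⟨(1, 0), ⟨h1, 𝒱.zero_mem⟩, by simp [hℓ]⟩ (by
      rintro _ ⟨p, ⟨hp, hp'⟩, rfl⟩ hpos
      refine re_trace_nonneg_of_isMin hZ (h𝒜 _ hp) (fun δ hδ => ?_) hpos
      refine hmin _ (𝒜.add_mem hA (𝒜.smul_mem δ hp)) _ (𝒱.add_mem hV (𝒱.smul_mem δ hp')) ?_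
      rwa [← add_assoc])
  refine ⟨A, hA, V, hV, X, hX, hZ, fun A' hA' => ?_, hXZ, fun V' hV' => ?_⟩
  · have := hXL _ ⟨(A', 0), ⟨hA', 𝒱.zero_mem⟩, rfl⟩
    simpa [hℓ] using this
  · have h2 := hXL _ ⟨(0, V'), ⟨𝒜.zero_mem, hV'⟩, rfl⟩
    have h3 : (X * (W * V'ᴴ)).trace = star (Wᴴ * X * V').trace := by
      rw [← trace_conjTranspose, conjTranspose_mul, conjTranspose_mul,
        conjTranspose_conjTranspose, hX.isHermitian.eq, trace_mul_comm, Matrix.mul_assoc,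
        trace_mul_comm, Matrix.mul_assoc]
    have h4 : (X * (V' * Wᴴ)).trace = (Wᴴ * X * V').trace := by
      rw [trace_mul_comm, Matrix.mul_assoc, trace_mul_comm, Matrix.mul_assoc,
        trace_mul_comm, Matrix.mul_assoc]
    simp only [hℓ, LinearMap.coe_mk, AddHom.coe_mk, zero_sub, Matrix.mul_neg, Matrix.mul_add,
      trace_neg, trace_add, h3, h4] at h2
    simp at h2
    linarith

end Saddle

/-! ### Product operators and replacement maps -/

section ReplaceAlgebra

variable {N : ℕ} {a b : Type*}

/-- The operator `Z₁ ⊗ ⋯ ⊗ Z_N`, where `Z_j` is an operator on `I_j ⊗ O_j`. -/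
def prodSite (Z : Fin N → Matrix (a × b) (a × b) ℂ) : IOMatrix N a b :=
  Matrix.of fun s t => ∏ j, Z j (s.1 j, s.2 j) (t.1 j, t.2 j)

theorem prodSite_conjTranspose (Z : Fin N → Matrix (a × b) (a × b) ℂ) :
    (prodSite Z)ᴴ = prodSite fun j => (Z j)ᴴ := by
  ext s t
  simp [prodSite]

/-- Isolating the factor of slot j exhibits multilinearity, from which the next three lemmas follow.
-/
theorem prodSite_update (Z : Fin N → Matrix (a × b) (a × b) ℂ) (j : Fin N)
    (W : Matrix (a × b) (a × b) ℂ) (s t : IOIndex N a b) :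
    prodSite (Function.update Z j W) s t = W (s.1 j, s.2 j) (t.1 j, t.2 j) *
      ∏ i ∈ Finset.univ \ {j}, Z i (s.1 i, s.2 i) (t.1 i, t.2 i) := by
  have h := Finset.prod_update_of_mem (Finset.mem_univ j)
    (fun i => Z i (s.1 i, s.2 i) (t.1 i, t.2 i)) (W (s.1 j, s.2 j) (t.1 j, t.2 j))
  simp only [prodSite, Matrix.of_apply]
  rw [← h]
  refine Finset.prod_congr rfl fun i _ => ?_
  rcases eq_or_ne i j with rfl | hij
  · simp
  · simp [Function.update_of_ne hij]

theorem prodSite_update_add (Z : Fin N → Matrix (a × b) (a × b) ℂ) (j : Fin N)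
    (W W' : Matrix (a × b) (a × b) ℂ) :
    prodSite (Function.update Z j (W + W')) =
      prodSite (Function.update Z j W) + prodSite (Function.update Z j W') := by
  ext s t
  simp [prodSite_update, add_mul]

theorem prodSite_update_sub (Z : Fin N → Matrix (a × b) (a × b) ℂ) (j : Fin N)
    (W W' : Matrix (a × b) (a × b) ℂ) :
    prodSite (Function.update Z j (W - W')) =
      prodSite (Function.update Z j W) - prodSite (Function.update Z j W') := by
  ext s t
  simp [prodSite_update, sub_mul]

theorem prodSite_update_smul (Z : Fin N → Matrix (a × b) (a × b) ℂ) (j : Fin N) (c : ℂ)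
    (W : Matrix (a × b) (a × b) ℂ) :
    prodSite (Function.update Z j (c • W)) = c • prodSite (Function.update Z j W) := by
  ext s t
  simp [prodSite_update, mul_assoc]

section

variable [Fintype a] [Fintype b]

/-- A pair of label functions is a function into pairs, so this is distributivity. It makes traces
and products of product operators factor over the slots. -/
theorem sum_IOIndex_prod (f : Fin N → a × b → ℂ) :
    ∑ w : IOIndex N a b, ∏ j, f j (w.1 j, w.2 j) = ∏ j, ∑ w : a × b, f j w := by
  rw [Finset.prod_univ_sum, Fintype.piFinset_univ]
  exact ((Equiv.arrowProdEquivProdArrow (Fin N) (fun _ => a) fun _ => b).sum_comp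
    (fun w : IOIndex N a b => ∏ j, f j (w.1 j, w.2 j))).symm

theorem prodSite_mul (Z W : Fin N → Matrix (a × b) (a × b) ℂ) :
    prodSite Z * prodSite W = prodSite fun j => Z j * W j := by
  ext s t
  simp only [Matrix.mul_apply, prodSite, Matrix.of_apply, ← Finset.prod_mul_distrib]
  exact sum_IOIndex_prod fun j w => Z j (s.1 j, s.2 j) w * W j w (t.1 j, t.2 j)

theorem trace_prodSite (Z : Fin N → Matrix (a × b) (a × b) ℂ) :
    (prodSite Z).trace = ∏ j, (Z j).trace :=
  sum_IOIndex_prod fun j w => Z j w w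

end

variable [DecidableEq a] [DecidableEq b]

theorem prodSite_one : prodSite (fun _ : Fin N => (1 : Matrix (a × b) (a × b) ℂ)) = 1 := by
  ext s t
  simp only [prodSite, Matrix.of_apply, Matrix.one_apply, Finset.prod_ite_zero,
    Finset.prod_const_one]
  refine if_congr ?_ rfl rfl
  simp only [Finset.mem_univ, true_implies, Prod.ext_iff, funext_iff, forall_and]

/-- The matrix units are products of local matrix units. -/
theorem prodSite_single (s t : IOIndex N a b) :
    prodSite (fun j => kroneckerMap (· * ·) (single (s.1 j) (t.1 j) (1 : ℂ))
      (single (s.2 j) (t.2 j) (1 : ℂ))) = single s t 1 := by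
  ext u v
  simp only [prodSite, Matrix.of_apply, kroneckerMap_apply, single_apply, ite_zero_mul_ite_zero,
    mul_one, Finset.prod_ite_zero, Finset.prod_const_one]
  refine if_congr ?_ rfl rfl
  simp only [Finset.mem_univ, true_implies, Prod.ext_iff, funext_iff]
  grind

variable [Fintype a] [Fintype b]

/-- An induction principle: operators are linear combinations of product operators. -/
theorem prodSite_kronecker_induction {p : IOMatrix N a b → Prop}
    (h_add : ∀ X Y, p X → p Y → p (X + Y)) (h_smul : ∀ (c : ℂ) X, p X → p (c • X))
    (h_prod : ∀ (A : Fin N → Matrix a a ℂ) (B : Fin N → Matrix b b ℂ),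
      p (prodSite fun j => kroneckerMap (· * ·) (A j) (B j))) (X : IOMatrix N a b) : p X := by
  have hsingle : ∀ (s t : IOIndex N a b) (x : ℂ), p (single s t x) := fun s t x => by
    have := h_smul x _ (h_prod (fun j => single (s.1 j) (t.1 j) (1 : ℂ))
      fun j => single (s.2 j) (t.2 j) (1 : ℂ))
    rw [prodSite_single, smul_single, smul_eq_mul, mul_one] at this
    exact this
  induction X using Matrix.induction_on' with
  | h_zero =>
    have := h_smul 0 _ (h_prod (fun _ => 0) fun _ => 0)
    rwa [zero_smul] at this
  | h_add X Y hX hY => exact h_add X Y hX hY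
  | h_std_basis s t x => exact hsingle s t x

/-- Product operators span, so Xᴴ is also an admissible test operator, and tr(XXᴴ) = 0 forces X = 0.
-/
theorem eq_zero_of_trace_mul_prodSite {X : IOMatrix N a b}
    (h : ∀ Z : Fin N → Matrix (a × b) (a × b) ℂ, (X * prodSite Z).trace = 0) : X = 0 := by
  have key : ∀ Y, (X * Y).trace = 0 := fun Y => by
    induction Y using prodSite_kronecker_induction with
    | h_add Y Y' h1 h2 => rw [Matrix.mul_add, trace_add, h1, h2, add_zero]
    | h_smul c Y h1 => rw [Matrix.mul_smul, trace_smul, h1, smul_zero]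
    | h_prod A B => exact h _
  exact trace_mul_conjTranspose_self_eq_zero_iff.mp (key Xᴴ)

/-- Trace out and replace by the normalized identity, if `p` holds. -/
noncomputable def depolarizeIf {c : Type*} [Fintype c] [DecidableEq c] (p : Prop) [Decidable p]
    (A : Matrix c c ℂ) : Matrix c c ℂ :=
  if p then (A.trace / Fintype.card c) • 1 else A

/-- The local version of `replaceMap` on `I_j ⊗ O_j`. -/
noncomputable def siteReplace (p r : Prop) [Decidable p] [Decidable r]
    (Z : Matrix (a × b) (a × b) ℂ) : Matrix (a × b) (a × b) ℂ :=
  Matrix.of fun x y =>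
    if (p → x.1 = y.1) ∧ (r → x.2 = y.2) then
      (Fintype.card (a × b) : ℂ)⁻¹ * ∑ w : a × b,
        Z (if p then w.1 else x.1, if r then w.2 else x.2)
          (if p then w.1 else y.1, if r then w.2 else y.2)
    else 0

theorem replaceMap_prodSite (P R : Finset (Fin N)) (Z : Fin N → Matrix (a × b) (a × b) ℂ) :
    replaceMap P R (prodSite Z) = prodSite fun j => siteReplace (j ∈ P) (j ∈ R) (Z j) := by
  ext s t
  simp only [replaceMap, LinearMap.coe_mk, AddHom.coe_mk, Matrix.of_apply, prodSite, siteReplace,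
    Finset.prod_ite_zero, Finset.mem_univ, true_implies, forall_and, Finset.prod_mul_distrib,
    Finset.prod_const, Finset.card_univ, Fintype.card_fin]
  congr 1
  congr 1
  · rw [Fintype.card_prod, Fintype.card_prod, Fintype.card_fun, Fintype.card_fun,
      Fintype.card_fin]
    push_cast
    rw [inv_pow, mul_pow]
  · rw [← sum_IOIndex_prod]
    rfl

variable [Nonempty a] [Nonempty b]

theorem siteReplace_kronecker (p r : Prop) [Decidable p] [Decidable r]
    (A : Matrix a a ℂ) (B : Matrix b b ℂ) :
    siteReplace p r (kroneckerMap (· * ·) A B) =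
      kroneckerMap (· * ·) (depolarizeIf p A) (depolarizeIf r B) := by
  have ha : (Fintype.card a : ℂ) ≠ 0 := by simp
  have hb : (Fintype.card b : ℂ) ≠ 0 := by simp
  ext x y
  by_cases hp : p <;> by_cases hr : r <;>
    simp only [siteReplace, depolarizeIf, hp, hr, Matrix.of_apply, kroneckerMap_apply, if_true,
      if_false, true_implies, false_implies, and_true, true_and, Matrix.smul_apply,
      Matrix.one_apply, smul_eq_mul, Fintype.card_prod, Nat.cast_mul, Fintype.sum_prod_type,
      Finset.sum_const, Finset.card_univ, nsmul_eq_mul, trace, diag_apply,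
      ← Finset.mul_sum, ← Finset.sum_mul]
  · by_cases h1 : x.1 = y.1 <;> by_cases h2 : x.2 = y.2 <;> simp [h1, h2]
    field_simp
  · by_cases h1 : x.1 = y.1 <;> simp [h1]
    field_simp
  · by_cases h2 : x.2 = y.2 <;> simp [h2]
    field_simp
  · field_simp

/-- Identities among replacement maps can be checked on these operators, where they become
statements about depolarising a single tensor factor. -/
theorem replaceMap_kronecker (P R : Finset (Fin N)) (A : Fin N → Matrix a a ℂ)
    (B : Fin N → Matrix b b ℂ) :
    replaceMap P R (prodSite fun j => kroneckerMap (· * ·) (A j) (B j)) =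
      prodSite fun j => kroneckerMap (· * ·) (depolarizeIf (j ∈ P) (A j))
        (depolarizeIf (j ∈ R) (B j)) := by
  simp only [replaceMap_prodSite, siteReplace_kronecker]

theorem depolarizeIf_depolarizeIf {c : Type*} [Fintype c] [DecidableEq c] [Nonempty c]
    (p p' : Prop) [Decidable p] [Decidable p'] (A : Matrix c c ℂ) :
    depolarizeIf p (depolarizeIf p' A) = depolarizeIf (p ∨ p') A := by
  have hc : (Fintype.card c : ℂ) ≠ 0 := by simp
  by_cases hp : p <;> by_cases hp' : p' <;> simp [depolarizeIf, hp, hp']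

theorem trace_depolarizeIf_mul {c : Type*} [Fintype c] [DecidableEq c]
    (p : Prop) [Decidable p] (A B : Matrix c c ℂ) :
    (depolarizeIf p A * B).trace = (A * depolarizeIf p B).trace := by
  by_cases hp : p <;> simp [depolarizeIf, hp]
  ring

theorem depolarizeIf_conjTranspose {c : Type*} [Fintype c] [DecidableEq c]
    (p : Prop) [Decidable p] (A : Matrix c c ℂ) :
    depolarizeIf p Aᴴ = (depolarizeIf p A)ᴴ := by
  by_cases hp : p <;> simp [depolarizeIf, hp]

/-- Depolarising a factor twice equals doing it once. Hence the replacement maps are commuting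
idempotents and their algebra is that of unions of subsystems. -/
theorem replaceMap_mul (P R P' R' : Finset (Fin N)) :
    (replaceMap P R * replaceMap P' R' : Module.End ℂ (IOMatrix N a b)) =
      replaceMap (P ∪ P') (R ∪ R') := by
  ext1 X
  rw [Module.End.mul_apply]
  induction X using prodSite_kronecker_induction with
  | h_add X Y h1 h2 => simp only [map_add, h1, h2]
  | h_smul c X h => simp only [map_smul, h]
  | h_prod A B =>
    simp only [replaceMap_kronecker, depolarizeIf_depolarizeIf]
    congr 1
    ext1 j
    congr 1 <;> exact if_congr (by simp) rfl rfl

theorem trace_replaceMap_mul (P R : Finset (Fin N)) (X Y : IOMatrix N a b) :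
    (replaceMap P R X * Y).trace = (X * replaceMap P R Y).trace := by
  induction X using prodSite_kronecker_induction with
  | h_add X X' h1 h2 => simp only [map_add, Matrix.add_mul, trace_add, h1, h2]
  | h_smul c X h => simp only [map_smul, Matrix.smul_mul, trace_smul, h]
  | h_prod A B =>
    induction Y using prodSite_kronecker_induction with
    | h_add X X' h1 h2 => simp only [map_add, Matrix.mul_add, trace_add, h1, h2]
    | h_smul c X h => simp only [map_smul, Matrix.mul_smul, trace_smul, h]
    | h_prod A' B' =>
      simp only [replaceMap_kronecker, prodSite_mul, trace_prodSite, ← mul_kronecker_mul,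
        trace_kronecker, trace_depolarizeIf_mul]

theorem replaceMap_conjTranspose (P R : Finset (Fin N)) (X : IOMatrix N a b) :
    replaceMap P R Xᴴ = (replaceMap P R X)ᴴ := by
  induction X using prodSite_kronecker_induction with
  | h_add X Y h1 h2 => simp only [map_add, conjTranspose_add, h1, h2]
  | h_smul c X h => simp only [map_smul, conjTranspose_smul, h]
  | h_prod A B =>
    simp only [replaceMap_kronecker, prodSite_conjTranspose, conjTranspose_kronecker,
      depolarizeIf_conjTranspose]

theorem depolarizeIf_one {c : Type*} [Fintype c] [DecidableEq c] [Nonempty c]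
    (p : Prop) [Decidable p] : depolarizeIf p (1 : Matrix c c ℂ) = 1 := by
  by_cases hp : p <;> simp [depolarizeIf, hp]

theorem replaceMap_one (P R : Finset (Fin N)) :
    replaceMap P R (1 : IOMatrix N a b) = 1 := by
  have h := replaceMap_kronecker P R (fun _ => (1 : Matrix a a ℂ)) fun _ => (1 : Matrix b b ℂ)
  simpa only [depolarizeIf_one, one_kronecker_one, prodSite_one] using h

end ReplaceAlgebra

/-! ### The projections `Λ` -/

section LamAlgebra

variable {n : Type*}

/-- `f` commutes with taking adjoints. -/
def IsStarPreserving (f : Module.End ℂ (Matrix n n ℂ)) : Prop :=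
  ∀ X, f Xᴴ = (f X)ᴴ

namespace IsStarPreserving

variable {f g : Module.End ℂ (Matrix n n ℂ)}

theorem one : IsStarPreserving (1 : Module.End ℂ (Matrix n n ℂ)) := fun _ => rfl

theorem add (hf : IsStarPreserving f) (hg : IsStarPreserving g) :
    IsStarPreserving (f + g) := fun X => by
  simp only [LinearMap.add_apply, conjTranspose_add, hf X, hg X]

theorem sub (hf : IsStarPreserving f) (hg : IsStarPreserving g) :
    IsStarPreserving (f - g) := fun X => by
  simp only [LinearMap.sub_apply, conjTranspose_sub, hf X, hg X]

theorem sum {ι : Type*} {s : Finset ι} {f : ι → Module.End ℂ (Matrix n n ℂ)}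
    (hf : ∀ i ∈ s, IsStarPreserving (f i)) : IsStarPreserving (∑ i ∈ s, f i) := fun X => by
  simp only [LinearMap.sum_apply, conjTranspose_sum]
  exact Finset.sum_congr rfl fun i hi => hf i hi X

theorem mul (hf : IsStarPreserving f) (hg : IsStarPreserving g) :
    IsStarPreserving (f * g) := fun X => by
  rw [Module.End.mul_apply, hg, hf, ← Module.End.mul_apply]

end IsStarPreserving

variable [Fintype n]

/-- `f` is self-adjoint for the bilinear form `tr (X Y)`. -/
def IsTraceSelfAdjoint (f : Module.End ℂ (Matrix n n ℂ)) : Prop :=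
  ∀ X Y, (f X * Y).trace = (X * f Y).trace

namespace IsTraceSelfAdjoint

variable {f g : Module.End ℂ (Matrix n n ℂ)}

theorem one : IsTraceSelfAdjoint (1 : Module.End ℂ (Matrix n n ℂ)) := fun _ _ => rfl

theorem add (hf : IsTraceSelfAdjoint f) (hg : IsTraceSelfAdjoint g) :
    IsTraceSelfAdjoint (f + g) := fun X Y => by
  simp only [LinearMap.add_apply, Matrix.add_mul, Matrix.mul_add, trace_add, hf X Y, hg X Y]

theorem sub (hf : IsTraceSelfAdjoint f) (hg : IsTraceSelfAdjoint g) :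
    IsTraceSelfAdjoint (f - g) := fun X Y => by
  simp only [LinearMap.sub_apply, Matrix.sub_mul, Matrix.mul_sub, trace_sub, hf X Y, hg X Y]

theorem sum {ι : Type*} {s : Finset ι} {f : ι → Module.End ℂ (Matrix n n ℂ)}
    (hf : ∀ i ∈ s, IsTraceSelfAdjoint (f i)) : IsTraceSelfAdjoint (∑ i ∈ s, f i) := fun X Y => by
  simp only [LinearMap.sum_apply, Matrix.sum_mul, Matrix.mul_sum, trace_sum]
  exact Finset.sum_congr rfl fun i hi => hf i hi X Y

theorem mul (hf : IsTraceSelfAdjoint f) (hg : IsTraceSelfAdjoint g) (h : Commute f g) :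
    IsTraceSelfAdjoint (f * g) := fun X Y => by
  rw [Module.End.mul_apply, hf, hg, ← Module.End.mul_apply, h.eq]

end IsTraceSelfAdjoint

/-- The fixed points of a self-adjoint projection form the orthogonal complement of its kernel. -/
theorem IsTraceSelfAdjoint.apply_eq_self_iff {f : Module.End ℂ (Matrix n n ℂ)}
    (hf : IsTraceSelfAdjoint f) (hs : IsStarPreserving f) (hi : f * f = f)
    {X : Matrix n n ℂ} (hX : X.IsHermitian) :
    f X = X ↔ ∀ Y : Matrix n n ℂ, Y.IsHermitian → f Y = 0 → (X * Y).trace.re = 0 := by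
  constructor
  · intro h Y _ hY
    rw [← h, hf, hY, Matrix.mul_zero, trace_zero, Complex.zero_re]
  · intro h
    have hXf : (f X)ᴴ = f X := by rw [← hs, hX.eq]
    have hY : (X - f X).IsHermitian := by
      change (X - f X)ᴴ = _
      rw [conjTranspose_sub, hX.eq, hXf]
    -- The defect X - f X lies in the kernel, so it is an allowed test operator and turns out
    -- orthogonal to itself.
    have hfY : f (X - f X) = 0 := by
      rw [map_sub, ← Module.End.mul_apply, hi, sub_self]
    have h1 := h _ hY hfY
    have h2 : (f X * (X - f X)).trace = 0 := by
      rw [hf, hfY, Matrix.mul_zero, trace_zero]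
    have h3 : X - f X = 0 := hY.eq_zero_of_trace_mul_self (by
      rw [Matrix.sub_mul, trace_sub, Complex.sub_re, h1, h2, Complex.zero_re, sub_self])
    exact (sub_eq_zero.mp h3).symm

end LamAlgebra

section Lam

variable {N : ℕ} {a b : Type*} [Fintype a] [DecidableEq a] [Fintype b] [DecidableEq b]

/-- The projections `P_k` for the sequential strategies. -/
noncomputable def seqProj (N : ℕ) (a b : Type*) [Fintype a] [DecidableEq a] [Fintype b]
    [DecidableEq b] (k : Fin N) : Module.End ℂ (IOMatrix N a b) :=
  replaceMap (later k) (later k) - replaceMap (later k) (insert k (later k))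

/-- The local projection `1 - O_j + I_j O_j`. -/
noncomputable def icoProj (N : ℕ) (a b : Type*) [Fintype a] [DecidableEq a] [Fintype b]
    [DecidableEq b] (j : Fin N) : Module.End ℂ (IOMatrix N a b) :=
  1 - replaceMap ∅ {j} + replaceMap {j} {j}

theorem Lam_ii_eq : (Lam .ii : Module.End ℂ (IOMatrix N a b)) = 1 - ∑ k, seqProj N a b k := rfl

theorem Lam_iv_eq : (Lam .iv : Module.End ℂ (IOMatrix N a b)) =
    1 - ((List.finRange N).map (icoProj N a b)).prod + replaceMap Finset.univ Finset.univ := rfl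

variable [Nonempty a] [Nonempty b]

theorem replaceMap_commute (P R P' R' : Finset (Fin N)) :
    Commute (replaceMap P R : Module.End ℂ (IOMatrix N a b)) (replaceMap P' R') := by
  change _ * _ = _ * _
  rw [replaceMap_mul, replaceMap_mul, Finset.union_comm P, Finset.union_comm R]

theorem replaceMap_isTraceSelfAdjoint (P R : Finset (Fin N)) :
    IsTraceSelfAdjoint (replaceMap P R : Module.End ℂ (IOMatrix N a b)) :=
  trace_replaceMap_mul P R

theorem replaceMap_isStarPreserving (P R : Finset (Fin N)) :
    IsStarPreserving (replaceMap P R : Module.End ℂ (IOMatrix N a b)) :=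
  replaceMap_conjTranspose P R

theorem seqProj_mul_self (k : Fin N) : seqProj N a b k * seqProj N a b k = seqProj N a b k := by
  simp only [seqProj, mul_sub, sub_mul, replaceMap_mul, Finset.union_idempotent]
  rw [Finset.union_eq_right.mpr (Finset.subset_insert _ _),
    Finset.union_eq_left.mpr (Finset.subset_insert _ _)]
  abel

theorem seqProj_commute (j k : Fin N) : Commute (seqProj N a b j) (seqProj N a b k) := by
  have h := replaceMap_commute (N := N) (a := a) (b := b)
  exact ((h _ _ _ _).sub_right (h _ _ _ _)).sub_left ((h _ _ _ _).sub_right (h _ _ _ _))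

/-- Everything traced out by either term of the k-th projection is already traced out by the j-th
one, so the two terms become equal and cancel. -/
theorem seqProj_mul_of_lt {j k : Fin N} (hjk : j < k) :
    seqProj N a b j * seqProj N a b k = 0 := by
  have h1 : insert k (later k) ⊆ later j := by
    intro i hi
    simp only [later, Finset.mem_insert, Finset.mem_filter, Finset.mem_univ, true_and] at hi ⊢
    rcases hi with rfl | hi
    · exact hjk
    · exact hjk.trans hi
  have h2 : later k ⊆ later j := (Finset.subset_insert _ _).trans h1
  simp only [seqProj, mul_sub, sub_mul, replaceMap_mul]
  rw [Finset.union_eq_left.mpr h1, Finset.union_eq_left.mpr h2,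
    Finset.union_eq_left.mpr (h1.trans (Finset.subset_insert j _)),
    Finset.union_eq_left.mpr (h2.trans (Finset.subset_insert j _))]
  abel

theorem seqProj_mul_of_ne {j k : Fin N} (hjk : j ≠ k) :
    seqProj N a b j * seqProj N a b k = 0 := by
  rcases hjk.lt_or_gt with h | h
  · exact seqProj_mul_of_lt h
  · rw [(seqProj_commute j k).eq, seqProj_mul_of_lt h]

/-- The projections are mutually orthogonal, so their sum is idempotent and vanishes on X only if
each of them does. This lets one equation encode all the comb conditions. -/
theorem seqProj_mul_sum (j : Fin N) :
    seqProj N a b j * ∑ k, seqProj N a b k = seqProj N a b j := by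
  rw [Finset.mul_sum, Finset.sum_eq_single j (fun k _ hk => seqProj_mul_of_ne hk.symm)
    (fun h => absurd (Finset.mem_univ j) h), seqProj_mul_self]

theorem icoProj_commute_replaceMap (j : Fin N) (P R : Finset (Fin N)) :
    Commute (icoProj N a b j) (replaceMap P R) :=
  ((Commute.one_left _).sub_left (replaceMap_commute _ _ _ _)).add_left (replaceMap_commute _ _ _ _)

theorem icoProj_commute (j k : Fin N) : Commute (icoProj N a b j) (icoProj N a b k) :=
  ((Commute.one_right _).sub_right (icoProj_commute_replaceMap _ _ _)).add_right
    (icoProj_commute_replaceMap _ _ _)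

theorem icoProj_mul_self (j : Fin N) : icoProj N a b j * icoProj N a b j = icoProj N a b j := by
  simp only [icoProj, mul_sub, sub_mul, mul_add, add_mul, one_mul, mul_one, replaceMap_mul,
    Finset.union_idempotent, Finset.empty_union, Finset.union_empty]
  abel

theorem icoProj_mul_univ (j : Fin N) : icoProj N a b j * replaceMap Finset.univ Finset.univ =
    replaceMap Finset.univ Finset.univ := by
  simp only [icoProj, sub_mul, add_mul, one_mul, replaceMap_mul,
    Finset.union_eq_right.mpr (Finset.subset_univ _)]
  abel

theorem icoProj_isTraceSelfAdjoint (j : Fin N) : IsTraceSelfAdjoint (icoProj N a b j) :=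
  (IsTraceSelfAdjoint.one.sub (replaceMap_isTraceSelfAdjoint _ _)).add
    (replaceMap_isTraceSelfAdjoint _ _)

theorem icoProj_isStarPreserving (j : Fin N) : IsStarPreserving (icoProj N a b j) :=
  (IsStarPreserving.one.sub (replaceMap_isStarPreserving _ _)).add
    (replaceMap_isStarPreserving _ _)

theorem icoProj_one (j : Fin N) : icoProj N a b j 1 = 1 := by
  simp [icoProj, replaceMap_one]

theorem icoProj_commute_list (j : Fin N) (l : List (Fin N)) :
    Commute (icoProj N a b j) (l.map (icoProj N a b)).prod :=
  Commute.list_prod_right _ _ fun x hx => by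
    obtain ⟨k, -, rfl⟩ := List.mem_map.mp hx
    exact icoProj_commute j k

theorem icoProj_list_mul_self (l : List (Fin N)) :
    (l.map (icoProj N a b)).prod * (l.map (icoProj N a b)).prod =
      (l.map (icoProj N a b)).prod := by
  induction l with
  | nil => simp
  | cons j l ih =>
    rw [List.map_cons, List.prod_cons]
    exact IsIdempotentElem.mul_of_commute (icoProj_commute_list j l) (icoProj_mul_self j) ih

theorem icoProj_list_mul_univ (l : List (Fin N)) :
    (l.map (icoProj N a b)).prod * replaceMap Finset.univ Finset.univ =
      replaceMap Finset.univ Finset.univ := by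
  induction l with
  | nil => simp
  | cons j l ih => rw [List.map_cons, List.prod_cons, mul_assoc, ih, icoProj_mul_univ]

theorem icoProj_list_isTraceSelfAdjoint (l : List (Fin N)) :
    IsTraceSelfAdjoint (l.map (icoProj N a b)).prod := by
  induction l with
  | nil => exact .one
  | cons j l ih =>
    rw [List.map_cons, List.prod_cons]
    exact (icoProj_isTraceSelfAdjoint j).mul ih (icoProj_commute_list j l)

theorem icoProj_list_isStarPreserving (l : List (Fin N)) :
    IsStarPreserving (l.map (icoProj N a b)).prod := by
  induction l with
  | nil => exact .one
  | cons j l ih =>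
    rw [List.map_cons, List.prod_cons]
    exact (icoProj_isStarPreserving j).mul ih

theorem icoProj_list_one (l : List (Fin N)) : (l.map (icoProj N a b)).prod 1 = 1 := by
  induction l with
  | nil => rfl
  | cons j l ih => rw [List.map_cons, List.prod_cons, Module.End.mul_apply, ih, icoProj_one]

theorem Lam_mul_self (k : StrategyType) :
    (Lam k * Lam k : Module.End ℂ (IOMatrix N a b)) = Lam k := by
  cases k with
  | i => simp only [Lam, replaceMap_mul, Finset.union_idempotent]
  | ii =>
    rw [Lam_ii_eq, mul_sub, mul_one, sub_mul, one_mul, Finset.sum_mul]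
    simp only [seqProj_mul_sum, sub_self, sub_zero]
  | iv =>
    -- Let Q be the product of the local projections and R the full replacement. From QR = RQ = R it
    -- follows that Q - R is idempotent, and so is 1 - (Q - R).
    have h1 := icoProj_list_mul_self (N := N) (a := a) (b := b) (List.finRange N)
    have h2 := icoProj_list_mul_univ (N := N) (a := a) (b := b) (List.finRange N)
    have h3 : Commute (replaceMap Finset.univ Finset.univ)
        ((List.finRange N).map (icoProj N a b)).prod :=
      Commute.list_prod_right _ _ fun x hx => by
        obtain ⟨k, -, rfl⟩ := List.mem_map.mp hx
        exact (icoProj_commute_replaceMap k _ _).symm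
    rw [Lam_iv_eq]
    simp only [mul_sub, sub_mul, mul_add, add_mul, one_mul, mul_one, h1, h2, h3.eq, replaceMap_mul,
      Finset.union_idempotent]
    abel

theorem Lam_isTraceSelfAdjoint (k : StrategyType) :
    IsTraceSelfAdjoint (Lam k : Module.End ℂ (IOMatrix N a b)) := by
  cases k with
  | i => exact replaceMap_isTraceSelfAdjoint _ _
  | ii =>
    exact IsTraceSelfAdjoint.one.sub (.sum fun k _ =>
      (replaceMap_isTraceSelfAdjoint _ _).sub (replaceMap_isTraceSelfAdjoint _ _))
  | iv =>
    exact (IsTraceSelfAdjoint.one.sub (icoProj_list_isTraceSelfAdjoint _)).add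
      (replaceMap_isTraceSelfAdjoint _ _)

theorem Lam_isStarPreserving (k : StrategyType) :
    IsStarPreserving (Lam k : Module.End ℂ (IOMatrix N a b)) := by
  cases k with
  | i => exact replaceMap_isStarPreserving _ _
  | ii =>
    exact IsStarPreserving.one.sub (.sum fun k _ =>
      (replaceMap_isStarPreserving _ _).sub (replaceMap_isStarPreserving _ _))
  | iv =>
    exact (IsStarPreserving.one.sub (icoProj_list_isStarPreserving _)).add
      (replaceMap_isStarPreserving _ _)

theorem Lam_one (k : StrategyType) : Lam k (1 : IOMatrix N a b) = 1 := by
  cases k with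
  | i => exact replaceMap_one _ _
  | ii => simp [Lam_ii_eq, seqProj, replaceMap_one]
  | iv => simp [Lam_iv_eq, replaceMap_one, icoProj_list_one]

/-- The map is self-adjoint and fixes the identity, so it preserves traces. Consequently the dual
objective is, up to a factor, the trace of the upper left block. -/
theorem trace_eq_zero_of_Lam_eq_zero {k : StrategyType} {Y : IOMatrix N a b} (hY : Lam k Y = 0) :
    Y.trace = 0 := by
  have h := Lam_isTraceSelfAdjoint k 1 Y
  rwa [hY, Lam_one, Matrix.one_mul, Matrix.mul_zero, trace_zero] at h

/-! ### Strategies and fixed points of `Λ` -/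

theorem Lam_i_eq_self_iff {X : IOMatrix N a b} (hX : X.PosSemidef) :
    (∃ ρ : Matrix (Fin N → a) (Fin N → a) ℂ, ρ.PosSemidef ∧ ρ.trace = 1 ∧
        X = kroneckerMap (· * ·) ρ (1 : Matrix (Fin N → b) (Fin N → b) ℂ)) ↔
      X.trace = (Fintype.card (Fin N → b) : ℂ) ∧ Lam .i X = X := by
  have ha : (Fintype.card (Fin N → a) : ℂ) ≠ 0 := by simp
  have hb : (Fintype.card (Fin N → b) : ℂ) ≠ 0 := by simp
  have happly : ∀ s t, Lam .i X s t = if s.2 = t.2 then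
      (Fintype.card (Fin N → b) : ℂ)⁻¹ * ∑ v, X (s.1, v) (t.1, v) else 0 := by
    intro s t
    simp only [Lam, replaceMap, LinearMap.coe_mk, AddHom.coe_mk, Matrix.of_apply]
    refine if_congr (by simp [funext_iff]) ?_ rfl
    simp only [Finset.piecewise_empty, Finset.piecewise_univ, Fintype.sum_prod_type,
      Finset.sum_const, Finset.card_univ, nsmul_eq_mul, Fintype.card_prod, Nat.cast_mul]
    field_simp
  constructor
  · rintro ⟨ρ, -, hρ, rfl⟩
    refine ⟨by rw [trace_kronecker, hρ, trace_one, one_mul], ?_⟩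
    ext s t
    rw [happly]
    by_cases h : s.2 = t.2
    · simp [h, mul_comm, Matrix.one_apply]
    · simp [h]
  · rintro ⟨htr, hfix⟩
    -- The partial trace over all outputs; ρ is this divided by d_O.
    set σ : Matrix (Fin N → a) (Fin N → a) ℂ :=
      ∑ v, X.submatrix (fun s => (s, v)) fun s => (s, v) with hσ
    refine ⟨(Fintype.card (Fin N → b) : ℂ)⁻¹ • σ, ?_, ?_, ?_⟩
    · refine PosSemidef.smul ?_ (inv_nonneg.mpr (Nat.cast_nonneg _))
      exact posSemidef_sum _ fun v _ => hX.submatrix _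
    · rw [trace_smul, smul_eq_mul, inv_mul_eq_one₀ hb, ← htr, hσ, trace_sum]
      simp only [trace, diag_apply, submatrix_apply, Fintype.sum_prod_type]
      exact Finset.sum_comm
    · ext s t
      conv_lhs => rw [← hfix, happly]
      simp [hσ, Matrix.one_apply, Matrix.sum_apply]

theorem Lam_ii_eq_self_iff (X : IOMatrix N a b) :
    (∀ k : Fin N, replaceMap (later k) (later k) X =
      replaceMap (later k) (insert k (later k)) X) ↔ Lam .ii X = X := by
  rw [Lam_ii_eq, LinearMap.sub_apply, Module.End.one_apply, sub_eq_self]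
  have h : ∀ k, replaceMap (later k) (later k) X =
      replaceMap (later k) (insert k (later k)) X ↔ seqProj N a b k X = 0 := fun k => by
    rw [seqProj, LinearMap.sub_apply, sub_eq_zero]
  simp only [h]
  constructor
  · intro hk
    rw [LinearMap.sum_apply]
    exact Finset.sum_eq_zero fun k _ => hk k
  · intro hs k
    rw [← seqProj_mul_sum, Module.End.mul_apply, hs, map_zero]

end Lam

/-! ### Choi operators of channels -/

section Choi

variable {N : ℕ} {a b : Type*} [DecidableEq a]

/-- The Choi operator of a single map. -/
def choiOf (M : Matrix a a ℂ →ₗ[ℂ] Matrix b b ℂ) : Matrix (a × b) (a × b) ℂ :=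
  Matrix.of fun x y => M (single x.1 y.1 1) x.2 y.2

theorem choiProd_eq_prodSite (M : Fin N → (Matrix a a ℂ →ₗ[ℂ] Matrix b b ℂ)) :
    choiProd M = prodSite fun j => choiOf (M j) := rfl

variable [Fintype b]

/-- `Z ≥ 0` and `tr_O Z = 𝟙_I`. -/
def IsChoi (Z : Matrix (a × b) (a × b) ℂ) : Prop :=
  Z.PosSemidef ∧ ∀ x x', ∑ y, Z (x, y) (x', y) = (1 : Matrix a a ℂ) x x'

theorem IsChoi.transpose {Z : Matrix (a × b) (a × b) ℂ} (hZ : IsChoi Z) : IsChoi Zᵀ :=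
  ⟨hZ.1.transpose, fun x x' => by
    simp only [transpose_apply, hZ.2, Matrix.one_apply, eq_comm]⟩

theorem isChoi_smul_one [DecidableEq b] [Nonempty b] :
    IsChoi ((Fintype.card b : ℂ)⁻¹ • (1 : Matrix (a × b) (a × b) ℂ)) := by
  refine ⟨PosSemidef.one.smul (inv_nonneg.mpr (Nat.cast_nonneg _)), fun x x' => ?_⟩
  by_cases h : x = x' <;> simp [Matrix.one_apply, h]

variable [Fintype a]

theorem IsChoi.trace_eq {Z : Matrix (a × b) (a × b) ℂ} (hZ : IsChoi Z) :
    Z.trace = Fintype.card a := by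
  simp only [trace, diag_apply, Fintype.sum_prod_type, hZ.2, Matrix.one_apply_eq]
  simp

theorem IsChannel.isChoi {M : Matrix a a ℂ →ₗ[ℂ] Matrix b b ℂ} (hM : IsChannel M) :
    IsChoi (choiOf M) := by
  constructor
  · set e := Fintype.equivFin a
    -- The unnormalised maximally entangled vector; complete positivity applied to its projector
    -- gives positivity of the Choi operator.
    set v : Fin (Fintype.card a) × a → ℂ := fun p => if e p.2 = p.1 then 1 else 0 with hv
    have h := (hM.1 _ _ (posSemidef_vecMulVec_self_star v)).submatrix fun p : a × b => (e p.1, p.2)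
    convert h using 1
    ext p r
    simp only [choiOf, Matrix.of_apply, submatrix_apply]
    refine congrFun₂ (congrArg (M ·) ?_) p.2 r.2
    ext x y
    simp only [hv, vecMulVec_apply, Pi.star_apply, single_apply, Matrix.of_apply,
      EmbeddingLike.apply_eq_iff_eq]
    by_cases h1 : x = p.1 <;> by_cases h2 : y = r.1 <;> simp [h1, h2, eq_comm]
  · intro x x'
    have h := hM.2 (single x x' 1)
    simp only [trace, diag_apply] at h
    simp only [choiOf, Matrix.of_apply, h, single_apply]
    rcases eq_or_ne x x' with rfl | hx
    · simp
    · simp only [Matrix.one_apply_ne hx]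
      exact Finset.sum_eq_zero fun i _ => if_neg fun h => hx (h.1.trans h.2.symm)

/-- Summing over c is sandwiching K with the identity on s tensored with the all-ones vector. -/
theorem Matrix.PosSemidef.contract {s c : Type*} [Fintype s] [Fintype c]
    {K : Matrix (s × c) (s × c) ℂ} (hK : K.PosSemidef) :
    (Matrix.of fun i j => ∑ x, ∑ y, K (i, x) (j, y) : Matrix s s ℂ).PosSemidef := by
  classical
  convert hK.conjTranspose_mul_mul_same ((1 : Matrix s s ℂ).submatrix (Prod.fst : s × c → s) id)
    using 1
  ext i j
  simp only [Matrix.mul_apply, Matrix.of_apply, conjTranspose_apply, submatrix_apply,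
    Fintype.sum_prod_type, Matrix.one_apply, id]
  simp only [apply_ite star, star_one, star_zero, ite_mul, one_mul, zero_mul, mul_ite, mul_one,
    mul_zero, Finset.sum_ite_irrel, Finset.sum_const_zero, Finset.sum_ite_eq', Finset.mem_univ,
    if_true]
  exact Finset.sum_comm

theorem IsChoi.exists_isChannel {Z : Matrix (a × b) (a × b) ℂ} (hZ : IsChoi Z) :
    ∃ M : Matrix a a ℂ →ₗ[ℂ] Matrix b b ℂ, IsChannel M ∧ choiOf M = Z := by
  refine ⟨{ toFun := fun ρ => Matrix.of fun y y' => ∑ x, ∑ x', ρ x x' * Z (x, y) (x', y')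
            map_add' := fun ρ σ => by
              ext y y'; simp [add_mul, Finset.sum_add_distrib]
            map_smul' := fun c ρ => by
              ext y y'; simp [Finset.mul_sum, mul_assoc] }, ⟨fun n ρ hρ => ?_, fun ρ => ?_⟩, ?_⟩
  · exact ((hρ.kronecker hZ.1).submatrix
      fun p : (Fin n × b) × a => ((p.1.1, p.2), (p.2, p.1.2))).contract
  · simp only [trace, diag_apply, LinearMap.coe_mk, AddHom.coe_mk, Matrix.of_apply]
    rw [Finset.sum_comm]
    refine Finset.sum_congr rfl fun x _ => ?_
    rw [Finset.sum_comm]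
    simp only [← Finset.mul_sum, hZ.2]
    simp [Matrix.one_apply]
  · ext p r
    simp only [choiOf, LinearMap.coe_mk, AddHom.coe_mk, Matrix.of_apply]
    rw [Finset.sum_eq_single p.1, Finset.sum_eq_single r.1]
    · simp
    · intro x _ hx; simp [hx.symm]
    · simp
    · intro x _ hx; simp [hx.symm]
    · simp

-- The entries are products of entries of pulled-back positive matrices, so the Schur product
-- theorem applies slot by slot.
omit [DecidableEq a] in
theorem prodSite_posSemidef {Z : Fin N → Matrix (a × b) (a × b) ℂ} (hZ : ∀ j, (Z j).PosSemidef) :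
    (prodSite Z).PosSemidef := by
  have h : ∀ S : Finset (Fin N), (Matrix.of fun s t : IOIndex N a b =>
      ∏ j ∈ S, Z j (s.1 j, s.2 j) (t.1 j, t.2 j)).PosSemidef := fun S => by
    induction S using Finset.induction_on with
    | empty =>
      convert posSemidef_vecMulVec_self_star (fun _ : IOIndex N a b => (1 : ℂ)) using 1
      ext s t
      simp [vecMulVec_apply]
    | insert j S hj ih =>
      have h := ((hZ j).submatrix fun s : IOIndex N a b => (s.1 j, s.2 j)).hadamard ih
      simp only [Finset.prod_insert hj]
      exact h
  exact h Finset.univ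

end Choi

/-! ### General strategies and fixed points of `Λ` -/

section IndefiniteOrder

variable {N : ℕ} {a b : Type*} [Fintype a] [DecidableEq a] [Fintype b] [DecidableEq b]

/-- Trace out and replace `O_j` in an operator on `I_j ⊗ O_j`. -/
noncomputable def outReplace (Z : Matrix (a × b) (a × b) ℂ) : Matrix (a × b) (a × b) ℂ :=
  Matrix.of fun x y =>
    if x.2 = y.2 then (Fintype.card b : ℂ)⁻¹ * ∑ v, Z (x.1, v) (y.1, v) else 0

/-- The projection `1 - O_j + I_j O_j` on operators on `I_j ⊗ O_j`. -/
noncomputable def icoSite (Z : Matrix (a × b) (a × b) ℂ) : Matrix (a × b) (a × b) ℂ :=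
  Z - outReplace Z + (Z.trace / Fintype.card (a × b)) • 1

variable [Nonempty a] [Nonempty b]

theorem siteReplace_of_not_of_not {p r : Prop} [Decidable p] [Decidable r] (hp : ¬p) (hr : ¬r)
    (Z : Matrix (a × b) (a × b) ℂ) : siteReplace p r Z = Z := by
  ext x y
  have ha : (Fintype.card a : ℂ) ≠ 0 := by simp
  have hb : (Fintype.card b : ℂ) ≠ 0 := by simp
  simp [siteReplace, hp, hr]
  field_simp

omit [Nonempty b] in
theorem siteReplace_of_not_of {p r : Prop} [Decidable p] [Decidable r] (hp : ¬p) (hr : r)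
    (Z : Matrix (a × b) (a × b) ℂ) : siteReplace p r Z = outReplace Z := by
  ext x y
  have ha : (Fintype.card a : ℂ) ≠ 0 := by simp
  simp [siteReplace, outReplace, hp, hr, Fintype.sum_prod_type]
  field_simp

omit [Nonempty a] [Nonempty b] in
theorem siteReplace_of_of {p r : Prop} [Decidable p] [Decidable r] (hp : p) (hr : r)
    (Z : Matrix (a × b) (a × b) ℂ) :
    siteReplace p r Z = (Z.trace / Fintype.card (a × b)) • 1 := by
  ext x y
  simp only [siteReplace, hp, hr, true_implies, ← Prod.ext_iff, Matrix.of_apply, if_true,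
    Matrix.smul_apply, Matrix.one_apply, smul_eq_mul, mul_ite, mul_one, mul_zero, trace,
    diag_apply]
  refine if_congr Iff.rfl ?_ rfl
  rw [div_eq_inv_mul]

theorem replaceMap_empty_singleton_prodSite (j : Fin N) (Z : Fin N → Matrix (a × b) (a × b) ℂ) :
    replaceMap ∅ {j} (prodSite Z) = prodSite (Function.update Z j (outReplace (Z j))) := by
  rw [replaceMap_prodSite]
  congr 1
  ext1 i
  rcases eq_or_ne i j with rfl | hij
  · rw [Function.update_self, siteReplace_of_not_of (by simp) (by simp)]
  · rw [Function.update_of_ne hij, siteReplace_of_not_of_not (by simp) (by simpa)]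

theorem replaceMap_singleton_singleton_prodSite (j : Fin N)
    (Z : Fin N → Matrix (a × b) (a × b) ℂ) :
    replaceMap {j} {j} (prodSite Z) =
      prodSite (Function.update Z j (((Z j).trace / Fintype.card (a × b)) • 1)) := by
  rw [replaceMap_prodSite]
  congr 1
  ext1 i
  rcases eq_or_ne i j with rfl | hij
  · rw [Function.update_self, siteReplace_of_of (by simp) (by simp)]
  · rw [Function.update_of_ne hij, siteReplace_of_not_of_not (by simpa) (by simpa)]

omit [Nonempty a] [Nonempty b] in
theorem replaceMap_univ_univ_prodSite (Z : Fin N → Matrix (a × b) (a × b) ℂ) :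
    replaceMap Finset.univ Finset.univ (prodSite Z) =
      prodSite fun j => ((Z j).trace / Fintype.card (a × b)) • 1 := by
  rw [replaceMap_prodSite]
  congr 1
  ext1 i
  rw [siteReplace_of_of (by simp) (by simp)]

theorem icoProj_prodSite (j : Fin N) (Z : Fin N → Matrix (a × b) (a × b) ℂ) :
    icoProj N a b j (prodSite Z) = prodSite (Function.update Z j (icoSite (Z j))) := by
  rw [icoSite, prodSite_update_add, prodSite_update_sub, Function.update_eq_self,
    ← replaceMap_empty_singleton_prodSite, ← replaceMap_singleton_singleton_prodSite]
  rfl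

theorem icoProj_list_prodSite (l : List (Fin N)) (hl : l.Nodup)
    (Z : Fin N → Matrix (a × b) (a × b) ℂ) :
    (l.map (icoProj N a b)).prod (prodSite Z) =
      prodSite fun j => if j ∈ l then icoSite (Z j) else Z j := by
  induction l with
  | nil => simp
  | cons j l ih =>
    rw [List.nodup_cons] at hl
    rw [List.map_cons, List.prod_cons, Module.End.mul_apply, ih hl.2, icoProj_prodSite]
    congr 1
    ext1 i
    rcases eq_or_ne i j with rfl | hij
    · simp [hl.1]
    · simp [hij]

theorem icoProj_finRange_prodSite (Z : Fin N → Matrix (a × b) (a × b) ℂ) :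
    ((List.finRange N).map (icoProj N a b)).prod (prodSite Z) =
      prodSite fun j => icoSite (Z j) := by
  rw [icoProj_list_prodSite _ (List.nodup_finRange N)]
  simp

omit [Fintype a] [Fintype b] [Nonempty a] [Nonempty b] in
theorem prodSite_smul_one (c : ℂ) :
    prodSite (fun _ : Fin N => c • (1 : Matrix (a × b) (a × b) ℂ)) = c ^ N • 1 := by
  rw [← prodSite_one]
  ext s t
  simp [prodSite, Finset.prod_mul_distrib]

omit [Fintype a] [DecidableEq a] [Nonempty a] in
theorem partialTrace_outReplace (Z : Matrix (a × b) (a × b) ℂ) (x x' : a) :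
    ∑ y, outReplace Z (x, y) (x', y) = ∑ y, Z (x, y) (x', y) := by
  simp [outReplace]

omit [DecidableEq a] [Nonempty a] [DecidableEq b] [Nonempty b] in
theorem trace_eq_sum_partialTrace (Z : Matrix (a × b) (a × b) ℂ) :
    Z.trace = ∑ x, ∑ y, Z (x, y) (x, y) := by
  simp only [trace, diag_apply, Fintype.sum_prod_type]

/-- Replacing the output does not change the partial trace, so the first two terms cancel and only
the multiple of the identity remains. By `mem_span_isChoi`, the image therefore lies in the span of
Choi operators. -/
theorem partialTrace_icoSite (Z : Matrix (a × b) (a × b) ℂ) (x x' : a) :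
    ∑ y, icoSite Z (x, y) (x', y) = (Z.trace / Fintype.card a) * (1 : Matrix a a ℂ) x x' := by
  have ha : (Fintype.card a : ℂ) ≠ 0 := by simp
  have hb : (Fintype.card b : ℂ) ≠ 0 := by simp
  simp only [icoSite, Matrix.add_apply, Matrix.sub_apply, Finset.sum_add_distrib,
    Finset.sum_sub_distrib, partialTrace_outReplace, sub_self, zero_add]
  rcases eq_or_ne x x' with rfl | h
  · simp
    field_simp
  · simp [h]

theorem trace_icoSite (Z : Matrix (a × b) (a × b) ℂ) : (icoSite Z).trace = Z.trace := by
  have ha : (Fintype.card a : ℂ) ≠ 0 := by simp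
  rw [trace_eq_sum_partialTrace]
  simp only [partialTrace_icoSite, Matrix.one_apply_eq, mul_one, Finset.sum_const,
    Finset.card_univ, nsmul_eq_mul]
  field_simp

/-- The partial trace of Z is already the identity, so both corrections equal the same multiple of
the identity. -/
theorem icoSite_of_isChoi {Z : Matrix (a × b) (a × b) ℂ} (hZ : IsChoi Z) : icoSite Z = Z := by
  have ha : (Fintype.card a : ℂ) ≠ 0 := by simp
  have h : outReplace Z = (Z.trace / Fintype.card (a × b)) • 1 := by
    ext x y
    simp only [outReplace, hZ.2, hZ.trace_eq, Matrix.of_apply, Matrix.smul_apply, Matrix.one_apply,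
      smul_eq_mul, Fintype.card_prod, Nat.cast_mul, Prod.ext_iff]
    by_cases h1 : x.1 = y.1 <;> by_cases h2 : x.2 = y.2 <;> simp [h1, h2]
    field_simp
  rw [icoSite, h, sub_add_cancel]

/-- Shift W by a large multiple of the identity to make it positive, then rescale it to a Choi
operator; the shift is itself a multiple of the Choi operator 1/d. -/
theorem mem_span_isChoi_of_isHermitian {W : Matrix (a × b) (a × b) ℂ} (hW : W.IsHermitian)
    {z : ℂ} (hz : ∀ x x', ∑ y, W (x, y) (x', y) = z * (1 : Matrix a a ℂ) x x') :
    W ∈ Submodule.span ℂ {Z : Matrix (a × b) (a × b) ℂ | IsChoi Z} := by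
  obtain ⟨x₀⟩ := (inferInstance : Nonempty a)
  have hzim : z.im = 0 := by
    have h := hz x₀ x₀
    rw [Matrix.one_apply_eq, mul_one] at h
    rw [← h, Complex.im_sum]
    exact Finset.sum_eq_zero fun y _ => Complex.conj_eq_iff_im.mp (hW.apply _ _)
  have hzre : z = (z.re : ℂ) := Complex.ext rfl (by simp [hzim])
  obtain ⟨c, hc0, hc⟩ := hW.neg.exists_posSemidef_smul_one_sub
  have hb : (1 : ℝ) ≤ Fintype.card b := by exact_mod_cast Fintype.card_pos
  have hb0 : (Fintype.card b : ℂ) ≠ 0 := by simp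
  -- The summand c secures positivity of the shifted operator, and |z.re| secures m > 0, so that
  -- dividing by m is legitimate.
  set d := c + |z.re| with hd
  have hd0 : 0 ≤ d := by positivity
  set m : ℝ := z.re + (d + 1) * Fintype.card b with hm
  have hm0 : 0 < m := by nlinarith [neg_abs_le z.re]
  have hmC : (m : ℂ) ≠ 0 := by exact_mod_cast hm0.ne'
  have hpos : (W + (d + 1 : ℝ) • (1 : Matrix (a × b) (a × b) ℂ)).PosSemidef := by
    convert hc.add ((PosSemidef.one (n := a × b) (R := ℂ)).real_smul
      (show 0 ≤ |z.re| + 1 by positivity)) using 1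
    rw [hd]
    module
  have hK : IsChoi (((m⁻¹ : ℝ) : ℂ) • (W + (d + 1 : ℝ) • (1 : Matrix (a × b) (a × b) ℂ))) := by
    refine ⟨hpos.smul (Complex.zero_le_real.mpr (inv_nonneg.mpr hm0.le)), fun x x' => ?_⟩
    simp only [Matrix.smul_apply, Matrix.add_apply, smul_eq_mul, ← Finset.mul_sum,
      Finset.sum_add_distrib, hz]
    have h1 : ∑ y : b, (d + 1 : ℝ) • (1 : Matrix (a × b) (a × b) ℂ) (x, y) (x', y) =
        ((d + 1) * Fintype.card b : ℂ) * (1 : Matrix a a ℂ) x x' := by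
      rcases eq_or_ne x x' with rfl | h
      · simp; ring
      · simp [h]
    rw [h1, ← add_mul, ← mul_assoc]
    have h2 : ((m⁻¹ : ℝ) : ℂ) * (z + (d + 1) * Fintype.card b) = 1 := by
      have : z + (d + 1) * Fintype.card b = (m : ℂ) := by
        rw [hm]; push_cast; rw [← hzre]
      rw [this, Complex.ofReal_inv, inv_mul_cancel₀ hmC]
    rw [h2, one_mul]
  have hdec : W = (m : ℂ) • (((m⁻¹ : ℝ) : ℂ) • (W + (d + 1 : ℝ) • (1 : Matrix (a × b) (a × b) ℂ)))
      - ((d + 1 : ℂ) * Fintype.card b) •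
        ((Fintype.card b : ℂ)⁻¹ • (1 : Matrix (a × b) (a × b) ℂ)) := by
    rw [smul_smul, smul_smul, Complex.ofReal_inv, mul_inv_cancel₀ hmC, one_smul,
      mul_assoc, mul_inv_cancel₀ hb0, mul_one]
    have : ((d + 1 : ℝ) • (1 : Matrix (a × b) (a × b) ℂ)) = ((d + 1 : ℂ)) • 1 := by
      rw [← Complex.ofReal_one, ← Complex.ofReal_add, Complex.coe_smul]
    rw [this, add_sub_cancel_right]
  rw [hdec]
  exact Submodule.sub_mem _ (Submodule.smul_mem _ _ (Submodule.subset_span hK))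
    (Submodule.smul_mem _ _ (Submodule.subset_span isChoi_smul_one))

/-- Choi operators of channels span the operators whose partial trace is a multiple of the
identity. -/
theorem mem_span_isChoi {W : Matrix (a × b) (a × b) ℂ} {z : ℂ}
    (hz : ∀ x x', ∑ y, W (x, y) (x', y) = z * (1 : Matrix a a ℂ) x x') :
    W ∈ Submodule.span ℂ {Z : Matrix (a × b) (a × b) ℂ | IsChoi Z} := by
  have hz' : ∀ x x', ∑ y, Wᴴ (x, y) (x', y) = star z * (1 : Matrix a a ℂ) x x' := fun x x' => by
    simp only [conjTranspose_apply, ← star_sum, hz]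
    rcases eq_or_ne x x' with rfl | h
    · simp
    · simp [h, h.symm]
  have h1 : (W + Wᴴ) ∈ Submodule.span ℂ {Z : Matrix (a × b) (a × b) ℂ | IsChoi Z} := by
    refine mem_span_isChoi_of_isHermitian (isHermitian_add_transpose_self W)
      (z := z + star z) fun x x' => ?_
    simp only [Matrix.add_apply, Finset.sum_add_distrib, hz, hz']
    ring
  have h2 : Complex.I • (W - Wᴴ) ∈ Submodule.span ℂ {Z : Matrix (a × b) (a × b) ℂ | IsChoi Z} := by
    refine mem_span_isChoi_of_isHermitian ?_ (z := Complex.I * (z - star z)) fun x x' => ?_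
    · change (Complex.I • (W - Wᴴ))ᴴ = _
      rw [conjTranspose_smul, conjTranspose_sub, conjTranspose_conjTranspose, ← neg_sub W,
        smul_neg]
      simp
    · simp only [Matrix.smul_apply, Matrix.sub_apply, smul_eq_mul, ← Finset.mul_sum,
        Finset.sum_sub_distrib, hz, hz']
      ring
  have hdec : W = (2⁻¹ : ℂ) • (W + Wᴴ) - (2⁻¹ * Complex.I) • (Complex.I • (W - Wᴴ)) := by
    rw [smul_smul, mul_assoc, Complex.I_mul_I]
    module
  rw [hdec]
  exact Submodule.sub_mem _ (Submodule.smul_mem _ _ h1) (Submodule.smul_mem _ _ h2)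

omit [Nonempty b] in
/-- If `X` has value `1` on all products of Choi operators of channels, then its values on
products of operators in their span are determined by multilinearity. -/
theorem trace_mul_prodSite_of_mem_span {X : IOMatrix N a b}
    (hX : ∀ Z : Fin N → Matrix (a × b) (a × b) ℂ, (∀ j, IsChoi (Z j)) →
      (X * prodSite Z).trace = 1)
    (Z : Fin N → Matrix (a × b) (a × b) ℂ)
    (hZ : ∀ j, Z j ∈ Submodule.span ℂ {Z : Matrix (a × b) (a × b) ℂ | IsChoi Z}) :
    (X * prodSite Z).trace = ∏ j, (Z j).trace / Fintype.card a := by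
  have ha : (Fintype.card a : ℂ) ≠ 0 := by simp
  -- S is the set of slots allowed to leave the Choi operators for their span; it is enlarged one
  -- slot at a time, using linearity in that slot.
  have key : ∀ (S : Finset (Fin N)) (Z : Fin N → Matrix (a × b) (a × b) ℂ),
      (∀ j ∉ S, IsChoi (Z j)) →
      (∀ j ∈ S, Z j ∈ Submodule.span ℂ {Z : Matrix (a × b) (a × b) ℂ | IsChoi Z}) →
      (X * prodSite Z).trace = ∏ j, (Z j).trace / Fintype.card a := by
    intro S
    induction S using Finset.induction_on with
    | empty =>
      intro Z h1 _
      have h1' : ∀ j, IsChoi (Z j) := fun j => h1 j (by simp)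
      rw [hX Z h1']
      simp [(h1' _).trace_eq]
    | insert j S hj ih =>
      intro Z h1 h2
      have hprod : ∀ W, ∏ i, (Function.update Z j W i).trace / (Fintype.card a : ℂ) =
          W.trace / Fintype.card a * ∏ i ∈ Finset.univ \ {j}, (Z i).trace / Fintype.card a := by
        intro W
        rw [← Finset.prod_update_of_mem (Finset.mem_univ j)
          (fun i => (Z i).trace / (Fintype.card a : ℂ))]
        refine Finset.prod_congr rfl fun i _ => ?_
        rcases eq_or_ne i j with rfl | hij
        · simp
        · simp [hij]
      have h3 : (X * prodSite (Function.update Z j (Z j))).trace =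
          ∏ i, (Function.update Z j (Z j) i).trace / (Fintype.card a : ℂ) := by
        have hmem := h2 j (Finset.mem_insert_self j S)
        generalize Z j = Zj at hmem ⊢
        induction hmem using Submodule.span_induction with
        | mem W hW =>
          refine ih _ (fun i hi => ?_) (fun i hi => ?_)
          · rcases eq_or_ne i j with rfl | hij
            · simpa using hW
            · rw [Function.update_of_ne hij]
              exact h1 i (by simp [hij, hi])
          · rw [Function.update_of_ne (by rintro rfl; exact hj hi)]
            exact h2 i (Finset.mem_insert_of_mem hi)
        | zero =>
          rw [hprod, ← zero_smul ℂ (0 : Matrix (a × b) (a × b) ℂ), prodSite_update_smul]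
          simp
        | add W W' _ _ hW hW' =>
          rw [hprod] at hW hW' ⊢
          rw [prodSite_update_add, Matrix.mul_add, trace_add, hW, hW', trace_add]
          ring
        | smul c W _ hW =>
          rw [hprod] at hW ⊢
          rw [prodSite_update_smul, Matrix.mul_smul, trace_smul, hW, trace_smul]
          simp only [smul_eq_mul]
          ring
      rwa [Function.update_eq_self] at h3
  exact key Finset.univ Z (fun j hj => absurd (Finset.mem_univ j) hj) fun j _ => hZ j

/-- Let Q be the product of the local projections and R the full replacement. On any product
operator, both give products in the span of Choi operators with equal traces in each slot, so a
normalised X cannot tell them apart; moving Q - R onto X by self-adjointness yields (Q - R)X = 0.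
Conversely, Q fixes a product of Choi operators and R sends it to 1/d_O, on which X has value tr X /
d_O = 1. -/
theorem Lam_iv_eq_self_iff (X : IOMatrix N a b) :
    (∀ Z : Fin N → Matrix (a × b) (a × b) ℂ, (∀ j, IsChoi (Z j)) →
      (X * prodSite Z).trace = 1) ↔
    X.trace = (Fintype.card (Fin N → b) : ℂ) ∧ Lam .iv X = X := by
  have ha : (Fintype.card a : ℂ) ≠ 0 := by simp
  have hb : (Fintype.card b : ℂ) ≠ 0 := by simp
  have hcard : (Fintype.card (Fin N → b) : ℂ) = (Fintype.card b : ℂ) ^ N := by simp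
  constructor
  · intro h
    refine ⟨?_, ?_⟩
    · have h1 := h _ fun _ => isChoi_smul_one
      rw [prodSite_smul_one, Matrix.mul_smul, Matrix.mul_one, trace_smul, smul_eq_mul, inv_pow,
        inv_mul_eq_one₀ (pow_ne_zero _ hb)] at h1
      rw [← h1, hcard]
    · have h2 : ((List.finRange N).map (icoProj N a b)).prod X -
          replaceMap Finset.univ Finset.univ X = 0 := by
        refine eq_zero_of_trace_mul_prodSite fun Z => ?_
        rw [Matrix.sub_mul, trace_sub, icoProj_list_isTraceSelfAdjoint, trace_replaceMap_mul,
          icoProj_finRange_prodSite, replaceMap_univ_univ_prodSite,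
          trace_mul_prodSite_of_mem_span h _ fun j => mem_span_isChoi (partialTrace_icoSite (Z j)),
          trace_mul_prodSite_of_mem_span h, sub_eq_zero]
        · refine Finset.prod_congr rfl fun j _ => ?_
          rw [trace_icoSite, trace_smul, trace_one]
          have : (Fintype.card (a × b) : ℂ) ≠ 0 := by simp
          rw [smul_eq_mul, div_mul_cancel₀ _ this]
        · intro j
          have h3 := Submodule.smul_mem _ ((Z j).trace / Fintype.card (a × b) * Fintype.card b)
            (Submodule.subset_span (isChoi_smul_one (a := a) (b := b)) :
              _ ∈ Submodule.span ℂ {Z : Matrix (a × b) (a × b) ℂ | IsChoi Z})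
          rwa [smul_smul, mul_assoc, mul_inv_cancel₀ hb, mul_one] at h3
      rw [Lam_iv_eq, LinearMap.add_apply, LinearMap.sub_apply, Module.End.one_apply, sub_add,
        h2, sub_zero]
  · rintro ⟨htr, hfix⟩ Z hZ
    rw [← hfix, Lam_isTraceSelfAdjoint, Lam_iv_eq, LinearMap.add_apply, LinearMap.sub_apply,
      icoProj_finRange_prodSite, replaceMap_univ_univ_prodSite]
    simp only [icoSite_of_isChoi (hZ _), (hZ _).trace_eq, Module.End.one_apply, sub_self, zero_add]
    rw [prodSite_smul_one, Matrix.mul_smul, Matrix.mul_one, trace_smul, htr, hcard,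
      Fintype.card_prod, smul_eq_mul, ← mul_pow]
    push_cast
    rw [div_mul_eq_mul_div, div_self (mul_ne_zero ha hb), one_pow]

end IndefiniteOrder

/-! ### Strategies as fixed points -/

section StrategyFixed

variable {N : ℕ} {a b : Type*} [Fintype a] [DecidableEq a] [Fintype b] [DecidableEq b]
  {F : Type*} [Fintype F]

omit [DecidableEq a] [DecidableEq b] in
theorem trace_linkProd (X : Matrix (IOIndex N a b × F) (IOIndex N a b × F) ℂ)
    (C : IOMatrix N a b) : (linkProd X C).trace = (traceF X * Cᵀ).trace := by
  simp only [linkProd, trace, diag_apply, Matrix.of_apply, Matrix.mul_apply, traceF,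
    Finset.sum_mul]
  rw [Finset.sum_comm]
  exact Finset.sum_congr rfl fun s _ => Finset.sum_comm

omit [Fintype a] [DecidableEq a] [Fintype b] [DecidableEq b] in
theorem traceF_posSemidef {X : Matrix (IOIndex N a b × F) (IOIndex N a b × F) ℂ}
    (hX : X.PosSemidef) : (traceF X).PosSemidef := by
  have h : traceF X = ∑ f, X.submatrix (fun s => (s, f)) fun s => (s, f) := by
    ext s t
    simp [traceF, Matrix.sum_apply]
  rw [h]
  exact posSemidef_sum _ fun f _ => hX.submatrix _

variable [Nonempty a] [Nonempty b]

theorem isStrategy_iff (k : StrategyType)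
    (X : Matrix (IOIndex N a b × F) (IOIndex N a b × F) ℂ) :
    IsStrategy k X ↔ X.PosSemidef ∧ (traceF X).trace = (Fintype.card (Fin N → b) : ℂ) ∧
      Lam k (traceF X) = traceF X := by
  refine and_congr_right fun hX => ?_
  cases k with
  | i => exact Lam_i_eq_self_iff (traceF_posSemidef hX)
  | ii => exact and_congr_right fun _ => Lam_ii_eq_self_iff _
  | iv =>
    rw [← Lam_iv_eq_self_iff]
    constructor
    · intro h Z hZ
      -- The link product pairs with the transpose, and Choi operators are closed under
      -- transposition, so the two quantifiers range over the same operators.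
      choose M hM hMZ using fun j => (hZ j).transpose.exists_isChannel
      have h1 := h M hM
      rw [trace_linkProd, choiProd_eq_prodSite] at h1
      simp only [hMZ] at h1
      exact h1
    · intro h M hM
      rw [trace_linkProd, choiProd_eq_prodSite]
      exact h (fun j => (choiOf (M j))ᵀ) fun j => (hM j).isChoi.transpose

end StrategyFixed

/-! ### Means of Choi operators -/

section Means

variable {N : ℕ} {a b : Type*} [Fintype a] [DecidableEq a] [Fintype b]
  {μ : Measure ℝ} {E : ℝ → (Matrix a a ℂ →ₗ[ℂ] Matrix b b ℂ)}

theorem choiN_posSemidef (hE : ∀ θ, IsChannel (E θ)) (θ : ℝ) : (choiN N E θ).PosSemidef :=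
  prodSite_posSemidef fun _ => (hE θ).isChoi.1

/-- The trace of the Choi operator does not depend on θ. This uniform bound makes a finite first
moment of μ enough for integrating θ C_θ. -/
theorem norm_choiN_le (hE : ∀ θ, IsChannel (E θ)) (θ : ℝ) (s t : IOIndex N a b) :
    ‖choiN N E θ s t‖ ≤ (Fintype.card a : ℝ) ^ N := by
  refine ((choiN_posSemidef hE θ).norm_entry_le_re_trace s t).trans (le_of_eq ?_)
  rw [choiN, choiProd_eq_prodSite, trace_prodSite]
  simp only [(hE θ).isChoi.trace_eq, Finset.prod_const, Finset.card_univ, Fintype.card_fin]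
  norm_cast

omit [Fintype a] [Fintype b] in
theorem measurable_choiN (hEmeas : ∀ (ρ : Matrix a a ℂ) (x y : b), Measurable fun θ => E θ ρ x y)
    (s t : IOIndex N a b) : Measurable fun θ => choiN N E θ s t := by
  simp only [choiN, choiProd, Matrix.of_apply]
  exact Finset.measurable_prod _ fun _ _ => hEmeas _ _ _

theorem integrable_choiN [IsFiniteMeasure μ] (hE : ∀ θ, IsChannel (E θ))
    (hEmeas : ∀ (ρ : Matrix a a ℂ) (x y : b), Measurable fun θ => E θ ρ x y)
    (s t : IOIndex N a b) : Integrable (fun θ => choiN N E θ s t) μ :=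
  Integrable.of_bound (measurable_choiN hEmeas s t).aestronglyMeasurable _
    (Filter.Eventually.of_forall fun θ => norm_choiN_le hE θ s t)

theorem integrable_smul_choiN (hμ : Integrable (fun θ : ℝ => θ) μ)
    (hE : ∀ θ, IsChannel (E θ))
    (hEmeas : ∀ (ρ : Matrix a a ℂ) (x y : b), Measurable fun θ => E θ ρ x y)
    (s t : IOIndex N a b) : Integrable (fun θ : ℝ => ((θ : ℂ) • choiN N E θ) s t) μ :=
  hμ.ofReal.mul_bdd (c := (Fintype.card a : ℝ) ^ N)
    (measurable_choiN hEmeas s t).aestronglyMeasurable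
    (Filter.Eventually.of_forall fun θ => norm_choiN_le hE θ s t)

omit [DecidableEq a] in
theorem meanMatrix_linkProd {F : Type*} (X : Matrix (IOIndex N a b × F) (IOIndex N a b × F) ℂ)
    {A : ℝ → IOMatrix N a b} (hA : ∀ s t, Integrable (fun θ => A θ s t) μ) :
    meanMatrix μ (fun θ => linkProd X (A θ)) = linkProd X (meanMatrix μ A) := by
  ext f g
  simp only [meanMatrix, linkProd, Matrix.of_apply, transpose_apply]
  rw [integral_finsetSum _ fun s _ => integrable_finsetSum _ fun t _ => (hA s t).const_mul _]
  refine Finset.sum_congr rfl fun s _ => ?_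
  rw [integral_finsetSum _ fun t _ => (hA s t).const_mul _]
  exact Finset.sum_congr rfl fun t _ => integral_const_mul _ _

omit [DecidableEq a] in
theorem linkProd_smul {F : Type*} (X : Matrix (IOIndex N a b × F) (IOIndex N a b × F) ℂ)
    (c : ℂ) (C : IOMatrix N a b) : linkProd X (c • C) = c • linkProd X C := by
  ext f g
  simp [linkProd, Finset.mul_sum, mul_left_comm]

theorem meanMatrix_mulVec {n : Type*} [Fintype n] {A : ℝ → Matrix n n ℂ}
    (hA : ∀ s t, Integrable (fun θ => A θ s t) μ) (u : n → ℂ) (s : n) :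
    (meanMatrix μ A *ᵥ u) s = ∫ θ, (A θ *ᵥ u) s ∂μ := by
  simp only [mulVec, dotProduct, meanMatrix, Matrix.of_apply]
  rw [integral_finsetSum _ fun t _ => (hA s t).mul_const _]
  exact Finset.sum_congr rfl fun t _ => (integral_mul_const _ _).symm

theorem integrable_mulVec {n : Type*} [Fintype n] {A : ℝ → Matrix n n ℂ}
    (hA : ∀ s t, Integrable (fun θ => A θ s t) μ) (u : n → ℂ) (s : n) :
    Integrable (fun θ => (A θ *ᵥ u) s) μ :=
  integrable_finsetSum _ fun t _ => (hA s t).mul_const _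

/-- A vector annihilated by the mean of positive semidefinite matrices is annihilated by almost
all of them. -/
theorem ae_mulVec_eq_zero_of_meanMatrix {n : Type*} [Fintype n] {A : ℝ → Matrix n n ℂ}
    (hA : ∀ s t, Integrable (fun θ => A θ s t) μ) (hpos : ∀ θ, (A θ).PosSemidef) {u : n → ℂ}
    (hu : meanMatrix μ A *ᵥ u = 0) : ∀ᵐ θ ∂μ, A θ *ᵥ u = 0 := by
  have hint : Integrable (fun θ => star u ⬝ᵥ A θ *ᵥ u) μ :=
    integrable_finsetSum _ fun s _ => (integrable_mulVec hA u s).const_mul _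
  have h0 : ∫ θ, star u ⬝ᵥ A θ *ᵥ u ∂μ = 0 := by
    have h1 : star u ⬝ᵥ meanMatrix μ A *ᵥ u = 0 := by rw [hu, dotProduct_zero]
    rw [← h1]
    simp only [dotProduct]
    rw [integral_finsetSum _ fun s _ => (integrable_mulVec hA u s).const_mul _]
    refine Finset.sum_congr rfl fun s _ => ?_
    rw [integral_const_mul, meanMatrix_mulVec hA]
  have hre : ∫ θ, (star u ⬝ᵥ A θ *ᵥ u).re ∂μ = 0 := by
    have := integral_re hint
    rw [h0] at this
    simpa using this
  have hnn : ∀ θ, 0 ≤ star u ⬝ᵥ A θ *ᵥ u := fun θ => (hpos θ).dotProduct_mulVec_nonneg u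
  have hae := (integral_eq_zero_iff_of_nonneg (fun θ => (Complex.le_def.mp (hnn θ)).1)
    hint.re).mp hre
  filter_upwards [hae] with θ hθ
  rw [← (hpos θ).dotProduct_mulVec_zero_iff]
  exact Complex.ext hθ (Complex.le_def.mp (hnn θ)).2.symm

/-- Columns killed by the mean are killed by almost every C_θ, hence by the θ-weighted mean. This
inclusion makes the equation for the score operator solvable. -/
theorem momentChoi_mul_eq_zero [IsFiniteMeasure μ] (hμ : Integrable (fun θ : ℝ => θ) μ)
    (hE : ∀ θ, IsChannel (E θ))
    (hEmeas : ∀ (ρ : Matrix a a ℂ) (x y : b), Measurable fun θ => E θ ρ x y)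
    {m : Type*} {T : Matrix (IOIndex N a b) m ℂ} (hT : meanChoi N μ E * T = 0) :
    momentChoi N μ E * T = 0 := by
  ext s j
  have h1 : meanChoi N μ E *ᵥ T.col j = 0 := by
    ext t
    exact congrFun (congrFun hT t) j
  have h2 := ae_mulVec_eq_zero_of_meanMatrix (integrable_choiN hE hEmeas)
    (choiN_posSemidef hE) h1
  change (momentChoi N μ E *ᵥ T.col j) s = 0
  rw [momentChoi, meanMatrix_mulVec (integrable_smul_choiN hμ hE hEmeas)]
  rw [integral_eq_zero_of_ae]
  filter_upwards [h2] with θ hθ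
  rw [smul_mulVec, hθ, smul_zero]
  rfl

end Means

/-! ### The link product with kernels -/

section Duality

variable {N : ℕ} {a b : Type*} [Fintype a] [DecidableEq a] [Fintype b] [DecidableEq b]

omit [DecidableEq a] [DecidableEq b] in
theorem trace_linkProd_mul {F : Type*} [Fintype F] [DecidableEq F]
    (X : Matrix (IOIndex N a b × F) (IOIndex N a b × F) ℂ) (C : IOMatrix N a b)
    (T : Matrix F F ℂ) :
    (linkProd X C * T).trace = (X * kroneckerMap (· * ·) Cᵀ T).trace := by
  simp only [trace, diag_apply, Matrix.mul_apply, linkProd, Matrix.of_apply,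
    kroneckerMap_apply, Fintype.sum_prod_type (α₁ := IOIndex N a b), transpose_apply,
    Finset.sum_mul]
  rw [Finset.sum_comm (s := (Finset.univ : Finset (IOIndex N a b)))
    (t := (Finset.univ : Finset F))]
  refine Finset.sum_congr rfl fun f _ => Finset.sum_comm.trans
    (Finset.sum_congr rfl fun s _ => Finset.sum_comm.trans ?_)
  simp only [mul_assoc]

/-- The link product pairs X with Cᵀ, and Φ* is the factor of that transpose; hence the conjugates
in the dual program. -/
theorem conj_mul_conjTranspose {n q : Type*} [Fintype q] (Φ : Matrix n q ℂ) :
    Φ.map star * (Φ.map star)ᴴ = (Φ * Φᴴ)ᵀ := by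
  ext s t
  simp [Matrix.mul_apply, mul_comm]

theorem Matrix.IsHermitian.map_star_eq {n : Type*} {H : Matrix n n ℂ} (hH : H.IsHermitian) :
    H.map star = Hᵀ := by
  conv_rhs => rw [← hH.eq]
  rfl

variable {q : ℕ}

omit [DecidableEq a] [DecidableEq b] in
/-- `M Φᵀ + Φ* M† = -2 (θC)ᵀ` for the corner `M` of the dual program. -/
theorem dualCorner_add {H : IOMatrix N a b} (hH : H.IsHermitian)
    (Φ : Matrix (IOIndex N a b) (Fin q) ℂ) {h : Matrix (Fin q) (Fin q) ℂ} (hh : h.IsHermitian) :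
    dualCorner H Φ h * (Φ.map star)ᴴ + Φ.map star * (dualCorner H Φ h)ᴴ =
      (2 : ℂ) • (H * (Φ * Φᴴ) + Φ * Φᴴ * H)ᵀ := by
  have h1 : (H.map star)ᴴ = H.map star := by
    rw [hH.map_star_eq, hH.transpose.eq]
  have e1 : (H * (Φ * Φᴴ) + Φ * Φᴴ * H)ᵀ = H.map star * (Φ.map star * (Φ.map star)ᴴ) +
      Φ.map star * (Φ.map star)ᴴ * H.map star := by
    rw [conj_mul_conjTranspose, hH.map_star_eq, ← transpose_mul, ← transpose_mul, transpose_add,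
      add_comm]
  rw [e1, dualCorner]
  -- The two terms containing h are adjoint to each other with opposite signs and cancel.
  generalize Φ.map star = Ψ
  generalize H.map star = K at h1 ⊢
  simp only [conjTranspose_smul, conjTranspose_sub, conjTranspose_mul, hh.eq, h1,
    Matrix.smul_mul, Matrix.mul_smul, Matrix.sub_mul, Matrix.mul_sub, Matrix.mul_assoc,
    Complex.star_def, Complex.conj_I, Complex.conj_ofNat]
  module

/-- Weak duality. -/
theorem information_le_of_dualFeasible [Nonempty a] [Nonempty b] {k : StrategyType}
    {C D H : IOMatrix N a b} (hH : H.IsHermitian) {Φ : Matrix (IOIndex N a b) (Fin q) ℂ}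
    (hΦ : Φ * Φᴴ = C) (hHC : -(H * C + C * H) = D)
    {h : Matrix (Fin q) (Fin q) ℂ} {l : ℝ} {Y : IOMatrix N a b} (hd : DualFeasible k H Φ h l Y)
    {F : Type*} [Fintype F] [DecidableEq F]
    {X : Matrix (IOIndex N a b × F) (IOIndex N a b × F) ℂ} (hX : IsStrategy k X)
    {S : Matrix F F ℂ} (hS : S.IsHermitian)
    (hSLD : (1 / 2 : ℂ) • (linkProd X C * S + S * linkProd X C) = linkProd X D) :
    (linkProd X C * (S * S)).trace.re ≤ l := by
  obtain ⟨hh, hY, hLY, hblock⟩ := hd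
  obtain ⟨hXpos, htr, hfix⟩ := (isStrategy_iff k X).mp hX
  have hb : (Fintype.card (Fin N → b) : ℂ) ≠ 0 := by simp
  have hcomp := (posSemidef_fromBlocks_one_iff _ _).mp hblock
  have hadd := dualCorner_add hH Φ hh
  rw [hΦ, ← neg_neg (H * C + C * H), hHC] at hadd
  have hΨ := conj_mul_conjTranspose Φ
  rw [hΦ] at hΨ
  generalize dualCorner H Φ h = M at hcomp hadd
  generalize Φ.map star = Ψ at hadd hΨ
  have hmom : (linkProd X D * S).trace = (linkProd X C * (S * S)).trace := by
    rw [← hSLD, Matrix.smul_mul, trace_smul, Matrix.add_mul, trace_add, Matrix.mul_assoc,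
      Matrix.mul_assoc, trace_mul_comm S, Matrix.mul_assoc]
    simp only [smul_eq_mul]
    ring
  have hsq : 0 ≤ (traceF X * (M * Mᴴ)).trace.re - (linkProd X C * (S * S)).trace.re := by
    -- The positive operator K Kᴴ with K = M ⊗ 1 + Ψ ⊗ S. Its cross terms contribute -2J and its
    -- last term +J, by the score equation.
    have h0 := hXpos.re_trace_mul_nonneg (posSemidef_mul_conjTranspose_self'
      (kroneckerMap (· * ·) M (1 : Matrix F F ℂ) + kroneckerMap (· * ·) Ψ S))
    have h1 : (kroneckerMap (· * ·) M (1 : Matrix F F ℂ) + kroneckerMap (· * ·) Ψ S) *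
        (kroneckerMap (· * ·) M (1 : Matrix F F ℂ) + kroneckerMap (· * ·) Ψ S)ᴴ =
        kroneckerMap (· * ·) ((M * Mᴴ)ᵀᵀ) (1 : Matrix F F ℂ) +
        kroneckerMap (· * ·) (((-2 : ℂ) • D)ᵀ) S + kroneckerMap (· * ·) Cᵀ (S * S) := by
      have h2 : ((-2 : ℂ) • D)ᵀ = M * Ψᴴ + Ψ * Mᴴ := by
        rw [hadd, transpose_neg, transpose_smul]; module
      rw [h2, ← hΨ, conjTranspose_add, conjTranspose_kronecker, conjTranspose_kronecker,
        Matrix.add_mul, Matrix.mul_add, Matrix.mul_add, ← mul_kronecker_mul, ← mul_kronecker_mul,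
        ← mul_kronecker_mul, ← mul_kronecker_mul, add_kronecker, hS.eq, conjTranspose_one,
        Matrix.one_mul, Matrix.mul_one, Matrix.one_mul, transpose_transpose]
      abel
    rw [h1, Matrix.mul_add, Matrix.mul_add, trace_add, trace_add, ← trace_linkProd_mul,
      ← trace_linkProd_mul, ← trace_linkProd_mul, Matrix.mul_one, trace_linkProd,
      transpose_transpose, linkProd_smul, Matrix.smul_mul, trace_smul, hmom] at h0
    simp only [Complex.add_re, smul_eq_mul] at h0
    have h3 : ((-2 : ℂ) * (linkProd X C * (S * S)).trace).re =
        -2 * (linkProd X C * (S * S)).trace.re := by simp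
    linarith
  have hXt := traceF_posSemidef hXpos
  have hle := hXt.re_trace_mul_nonneg hcomp
  have hXY := ((Lam_isTraceSelfAdjoint k).apply_eq_self_iff (Lam_isStarPreserving k)
    (Lam_mul_self k) hXt.isHermitian).mp hfix Y hY hLY
  rw [Matrix.mul_sub, trace_sub, Matrix.mul_add, trace_add, Matrix.mul_smul, Matrix.mul_one,
    trace_smul, htr, smul_eq_mul, div_mul_cancel₀ _ hb, Complex.sub_re, Complex.add_re, hXY,
    Complex.ofReal_re] at hle
  linarith

end Duality

/-! ### Strong duality and attainment -/

section Attainment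

theorem Matrix.map_star_mul {l m n : Type*} [Fintype m] (A : Matrix l m ℂ) (B : Matrix m n ℂ) :
    (A * B).map star = A.map star * B.map star := by
  ext s t
  simp [Matrix.mul_apply]

/-- Testing against Z + Zᴴ itself shows that its Hilbert-Schmidt norm vanishes. -/
theorem Matrix.add_conjTranspose_eq_zero {n : Type*} [Fintype n] {Z : Matrix n n ℂ}
    (h : ∀ A : Matrix n n ℂ, A.IsHermitian → (Z * A).trace.re = 0) : Z + Zᴴ = 0 := by
  have hH : (Z + Zᴴ).IsHermitian := isHermitian_add_transpose_self Z
  refine hH.eq_zero_of_trace_mul_self ?_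
  have h1 := h _ hH
  have h2 : (Zᴴ * (Z + Zᴴ)).trace = star (Z * (Z + Zᴴ)).trace := by
    rw [← trace_conjTranspose, conjTranspose_mul, hH.eq, trace_mul_comm]
  rw [Matrix.add_mul, trace_add, h2, Complex.add_re, h1]
  simpa using h1

/-- If `ker C ⊆ ker D`, where `C = Φ Φᴴ` and `D = -(H C + C H)`, then `H` maps the range of `Φ` to
itself. -/
theorem exists_mul_eq_mul_of_ker {n : Type*} [Fintype n] [DecidableEq n] {q : ℕ}
    {C D H : Matrix n n ℂ} (hH : H.IsHermitian) {Φ : Matrix n (Fin q) ℂ} (hΦ : Φ * Φᴴ = C)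
    (hHC : -(H * C + C * H) = D) (hker : ∀ T : Matrix n n ℂ, C * T = 0 → D * T = 0) :
    ∃ L : Matrix (Fin q) (Fin q) ℂ, H * Φ = Φ * L := by
  have hC : C.IsHermitian := by rw [← hΦ]; exact isHermitian_mul_conjTranspose_self Φ
  have hD : Dᴴ = D := by
    rw [← hHC]
    simp [hC.eq, hH.eq, add_comm]
  obtain ⟨S, hS, hCS⟩ := hC.exists_pseudoinverse
  have hCSΦ : C * S * Φ = Φ := by
    have h1 := mul_eq_self_of_pseudoinverse (G := Φᴴ) (S := S)
      (by rw [conjTranspose_conjTranspose, hΦ]; exact hCS)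
    have h2 := congrArg conjTranspose h1
    rw [conjTranspose_conjTranspose, hΦ] at h2
    simpa [hC.eq, hS.eq, Matrix.mul_assoc] using h2
  have hDSC : D = D * (S * C) := by
    have := hker (1 - S * C) (by rw [Matrix.mul_sub, Matrix.mul_one, ← Matrix.mul_assoc, hCS,
      sub_self])
    rwa [Matrix.mul_sub, Matrix.mul_one, sub_eq_zero] at this
  have hCSD : D = C * (S * D) := by
    conv_lhs => rw [← hD, hDSC]
    rw [conjTranspose_mul, conjTranspose_mul, hC.eq, hS.eq, hD, Matrix.mul_assoc]
  -- The kernel inclusion and its adjoint put D in the range of C; solving the defining equation for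
  -- H C puts H C there too.
  have hHC' : H * C = C * (-(S * D) - H) := by
    have : H * C = -D - C * H := by rw [← hHC]; abel
    rw [this, Matrix.mul_sub, Matrix.mul_neg, ← hCSD]
  refine ⟨Φᴴ * (-(S * D) - H) * S * Φ, ?_⟩
  calc H * Φ = H * C * S * Φ := by
        conv_lhs => rw [← hCSΦ]
        simp only [Matrix.mul_assoc]
    _ = Φ * (Φᴴ * (-(S * D) - H) * S * Φ) := by
        rw [hHC', ← hΦ]
        simp only [Matrix.mul_assoc]

variable {N : ℕ} {a b : Type*} [Fintype a] [DecidableEq a] [Fintype b] [DecidableEq b]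
  [Nonempty a] [Nonempty b] {q : ℕ}

/-- The subspace `{r 𝟙 + Y | Y Hermitian, Λ Y = 0}`. -/
noncomputable def dualSubspace (N : ℕ) (a b : Type*) [Fintype a] [DecidableEq a] [Fintype b]
    [DecidableEq b] (k : StrategyType) : Submodule ℝ (IOMatrix N a b) where
  carrier := {A | ∃ (r : ℝ) (Y : IOMatrix N a b), Y.IsHermitian ∧ Lam k Y = 0 ∧ A = r • 1 + Y}
  zero_mem' := ⟨0, 0, isHermitian_zero, map_zero _, by simp⟩
  add_mem' := by
    rintro _ _ ⟨r, Y, hY, hLY, rfl⟩ ⟨r', Y', hY', hLY', rfl⟩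
    exact ⟨r + r', Y + Y', hY.add hY', by rw [map_add, hLY, hLY', add_zero], by module⟩
  smul_mem' := by
    rintro c _ ⟨r, Y, hY, hLY, rfl⟩
    refine ⟨c * r, c • Y, ?_, ?_, by module⟩
    · change (c • Y)ᴴ = _
      rw [conjTranspose_smul, star_trivial, hY.eq]
    · rw [← Complex.coe_smul, map_smul, hLY, smul_zero]

/-- The directions `-2 i Φ* h` of the corner of the dual program. -/
noncomputable def cornerSubspace {n : Type*} (Ψ : Matrix n (Fin q) ℂ) :
    Submodule ℝ (Matrix n (Fin q) ℂ) where
  carrier := {V | ∃ h : Matrix (Fin q) (Fin q) ℂ, h.IsHermitian ∧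
    V = (-2 * Complex.I) • (Ψ * h)}
  zero_mem' := ⟨0, isHermitian_zero, by simp⟩
  add_mem' := by
    rintro _ _ ⟨h, hh, rfl⟩ ⟨h', hh', rfl⟩
    exact ⟨h + h', hh.add hh', by rw [Matrix.mul_add, smul_add]⟩
  smul_mem' := by
    rintro c _ ⟨h, hh, rfl⟩
    refine ⟨c • h, ?_, ?_⟩
    · change (c • h)ᴴ = _
      rw [conjTranspose_smul, star_trivial, hh.eq]
    · rw [Matrix.mul_smul, smul_comm]

/-- An optimal point of the dual program together with an optimal strategy traced over `F`. -/
theorem exists_dual_optimum (k : StrategyType) (H : IOMatrix N a b)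
    (Φ : Matrix (IOIndex N a b) (Fin q) ℂ) :
    ∃ (h : Matrix (Fin q) (Fin q) ℂ) (l : ℝ) (Y X : IOMatrix N a b), DualFeasible k H Φ h l Y ∧
      X.PosSemidef ∧ X.trace = (Fintype.card (Fin N → b) : ℂ) ∧ Lam k X = X ∧
      (X * (dualCorner H Φ h * (dualCorner H Φ h)ᴴ)).trace.re = l ∧
      ((Φ.map star)ᴴ * X * dualCorner H Φ h).IsHermitian := by
  set Ψ := Φ.map star with hΨ
  set dI : ℝ := (Fintype.card (Fin N → a) : ℝ) with hdI
  set dO : ℝ := (Fintype.card (Fin N → b) : ℝ) with hdO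
  have hdI0 : 0 < dI := by rw [hdI]; exact_mod_cast Fintype.card_pos
  have hdO0 : 0 < dO := by rw [hdO]; exact_mod_cast Fintype.card_pos
  have htr1 : (1 : IOMatrix N a b).trace = ((dI * dO : ℝ) : ℂ) := by
    rw [trace_one, hdI, hdO]; simp
  obtain ⟨A, ⟨r, Y, hY, hLY, rfl⟩, V, ⟨h, hh, rfl⟩, X, hX, hZ, hXA, hXZ, hXV⟩ :=
    exists_saddle_point (dualSubspace N a b k) (by
      rintro _ ⟨r, Y, hY, -, rfl⟩
      change (r • 1 + Y)ᴴ = _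
      rw [conjTranspose_add, hY.eq, conjTranspose_smul, star_trivial, conjTranspose_one])
      ⟨1, 0, isHermitian_zero, map_zero _, by simp⟩ ((2 : ℂ) • (H.map star * Ψ))
      (cornerSubspace Ψ)
  have hM : (2 : ℂ) • (H.map star * Ψ) + (-2 * Complex.I) • (Ψ * h) = dualCorner H Φ h := by
    rw [dualCorner]; module
  rw [hM] at hZ hXZ hXV
  set M := dualCorner H Φ h with hMdef
  have hXY : ∀ Y : IOMatrix N a b, Y.IsHermitian → Lam k Y = 0 → (X * Y).trace.re = 0 := by
    intro Y hY hLY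
    rw [hXA Y ⟨0, Y, hY, hLY, by simp⟩, trace_eq_zero_of_Lam_eq_zero hLY, Complex.zero_re]
  have hXtr : X.trace = ((dI * dO : ℝ) : ℂ) := by
    have h1 := hXA 1 ⟨1, 0, isHermitian_zero, map_zero _, by simp⟩
    rw [Matrix.mul_one, htr1, Complex.ofReal_re] at h1
    exact Complex.ext h1 hX.isHermitian.trace_im_eq_zero
  -- The multiplier has trace d_I d_O because it agrees with the trace functional on the identity,
  -- while a strategy needs d_O. Correspondingly λ = r d_O.
  have hX' : (dI⁻¹ • X).PosSemidef := hX.real_smul (inv_nonneg.mpr hdI0.le)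
  refine ⟨h, r * dO, Y, dI⁻¹ • X, ⟨hh, hY, hLY, ?_⟩, hX', ?_, ?_, ?_, ?_⟩
  · rw [posSemidef_fromBlocks_one_iff]
    have e : ((r * dO : ℝ) : ℂ) / (Fintype.card (Fin N → b) : ℂ) = (r : ℂ) := by
      have : (Fintype.card (Fin N → b) : ℂ) = (dO : ℂ) := by rw [hdO]; norm_cast
      rw [this, Complex.ofReal_mul, mul_div_cancel_right₀ _ (by exact_mod_cast hdO0.ne')]
    rw [e, Complex.coe_smul]
    exact hZ
  · rw [trace_smul, hXtr, Complex.real_smul, ← Complex.ofReal_mul, inv_mul_cancel_left₀ hdI0.ne',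
      hdO]
    norm_cast
  · rw [(Lam_isTraceSelfAdjoint k).apply_eq_self_iff (Lam_isStarPreserving k) (Lam_mul_self k)
      hX'.isHermitian]
    intro Y' hY' hLY'
    rw [Matrix.smul_mul, trace_smul, Complex.smul_re, hXY Y' hY' hLY', smul_zero]
  · rw [Matrix.mul_sub, trace_sub, Complex.sub_re, sub_eq_zero, Matrix.mul_add, trace_add,
      Complex.add_re, hXY Y hY hLY, Matrix.mul_smul, Matrix.mul_one, trace_smul, hXtr,
      Complex.smul_re, Complex.ofReal_re, smul_eq_mul, add_zero] at hXZ
    rw [Matrix.smul_mul, trace_smul, Complex.smul_re, ← hXZ, smul_eq_mul]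
    field_simp
  -- Stationarity in every Hermitian direction h' makes i MᴴXΨ anti-Hermitian, so MᴴXΨ is Hermitian.
  · have h1 : Complex.I • (Mᴴ * X * Ψ) + (Complex.I • (Mᴴ * X * Ψ))ᴴ = 0 := by
      refine add_conjTranspose_eq_zero fun h' hh' => ?_
      have h2 := hXV _ ⟨h', hh', rfl⟩
      have h3 : (Mᴴ * X * ((-2 * Complex.I) • (Ψ * h'))).trace =
          ((-2 : ℝ) : ℂ) * (Complex.I • (Mᴴ * X * Ψ) * h').trace := by
        rw [Matrix.mul_smul, trace_smul, Matrix.smul_mul, trace_smul, ← Matrix.mul_assoc]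
        simp only [smul_eq_mul]
        push_cast
        ring
      rw [h3, Complex.re_ofReal_mul] at h2
      linarith
    rw [conjTranspose_smul, Complex.star_def, Complex.conj_I, neg_smul, ← sub_eq_add_neg,
      ← smul_sub, smul_eq_zero, or_iff_right Complex.I_ne_zero, sub_eq_zero] at h1
    change (Ψᴴ * dI⁻¹ • X * M)ᴴ = _
    have h4 : Ψᴴ * X * M = (Mᴴ * X * Ψ)ᴴ := by simp [hX.isHermitian.eq, Matrix.mul_assoc]
    rw [Matrix.mul_smul, Matrix.smul_mul, conjTranspose_smul, star_trivial, h4,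
      conjTranspose_conjTranspose, ← h1]

omit [Fintype a] [DecidableEq a] [Fintype b] [DecidableEq b] [Nonempty a] [Nonempty b] in
theorem traceF_vecMulVec {F : Type*} [Fintype F] (R : Matrix (IOIndex N a b) F ℂ) :
    traceF (vecMulVec (fun p : IOIndex N a b × F => R p.1 p.2)
      (star fun p : IOIndex N a b × F => R p.1 p.2)) = R * Rᴴ := by
  ext s t
  simp [traceF, vecMulVec_apply, Matrix.mul_apply]

omit [DecidableEq a] [DecidableEq b] [Nonempty a] [Nonempty b] in
theorem linkProd_vecMulVec_transpose {F : Type*} (R : Matrix (IOIndex N a b) F ℂ)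
    (C : IOMatrix N a b) :
    (linkProd (vecMulVec (fun p : IOIndex N a b × F => R p.1 p.2)
      (star fun p : IOIndex N a b × F => R p.1 p.2)) C)ᵀ = Rᴴ * Cᵀ * R := by
  ext f g
  simp only [linkProd, vecMulVec_apply, Matrix.mul_apply, transpose_apply, Matrix.of_apply,
    conjTranspose_apply, Pi.star_apply, Finset.sum_mul]
  refine Finset.sum_congr rfl fun s _ => Finset.sum_congr rfl fun t _ => ?_
  ring

/-- An optimal strategy, together with its Bayesian score operator. -/
theorem exists_strategy_of_dual_optimum {k : StrategyType} {C D H : IOMatrix N a b}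
    (hH : H.IsHermitian) {Φ : Matrix (IOIndex N a b) (Fin q) ℂ} (hΦ : Φ * Φᴴ = C)
    (hHC : -(H * C + C * H) = D)
    (hker : ∀ T : IOMatrix N a b, C * T = 0 → D * T = 0)
    {h : Matrix (Fin q) (Fin q) ℂ} (hh : h.IsHermitian) {Xt : IOMatrix N a b}
    (hXt : Xt.PosSemidef) (htr : Xt.trace = (Fintype.card (Fin N → b) : ℂ)) (hfix : Lam k Xt = Xt)
    (hst : ((Φ.map star)ᴴ * Xt * dualCorner H Φ h).IsHermitian) :
    ∃ (d : ℕ) (X : Matrix (IOIndex N a b × Fin d) (IOIndex N a b × Fin d) ℂ)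
      (S : Matrix (Fin d) (Fin d) ℂ), IsStrategy k X ∧ S.IsHermitian ∧
      (1 / 2 : ℂ) • (linkProd X C * S + S * linkProd X C) = linkProd X D ∧
      (linkProd X C * (S * S)).trace.re =
        (Xt * (dualCorner H Φ h * (dualCorner H Φ h)ᴴ)).trace.re := by
  obtain ⟨L, hL⟩ := exists_mul_eq_mul_of_ker hH hΦ hHC hker
  have hadd := dualCorner_add hH Φ hh
  rw [hΦ, ← neg_neg (H * C + C * H), hHC] at hadd
  have hΨ := conj_mul_conjTranspose Φ
  rw [hΦ] at hΨ
  have hM : dualCorner H Φ h = Φ.map star * ((2 : ℂ) • (L.map star - Complex.I • h)) := by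
    rw [dualCorner, ← map_star_mul, hL, map_star_mul, Matrix.mul_smul, Matrix.mul_sub,
      Matrix.mul_smul]
  generalize dualCorner H Φ h = M at *
  generalize Φ.map star = Ψ at *
  obtain ⟨R₀, hR₀⟩ := hXt.exists_eq_mul_conjTranspose
  set d := Fintype.card (IOIndex N a b)
  -- The columns of the square-root factor are relabelled by `Fin d`, which becomes the purifying
  -- output space.
  set R : Matrix (IOIndex N a b) (Fin d) ℂ :=
    R₀.submatrix id (Fintype.equivFin (IOIndex N a b)).symm with hR
  have hRR : Xt = R * Rᴴ := by
    rw [hR₀, hR, conjTranspose_submatrix, submatrix_mul_equiv, submatrix_id_id]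
  -- For the purification by R and S = Bᵀ, this equation says that the positive term dropped in weak
  -- duality vanishes.
  obtain ⟨B, hB, hBG⟩ := exists_isHermitian_mul_eq (Rᴴ * Ψ) (-(Rᴴ * M)) (by
      have e : (Rᴴ * Ψ)ᴴ * -(Rᴴ * M) = -(Ψᴴ * Xt * M) := by
        rw [hRR]; simp [Matrix.mul_assoc]
      rw [e]
      exact hst.neg) (by
      intro T hT
      -- M factors through Ψ, so K T lies in the range of G = RᴴΨ; the Hermitian condition gives GᴴK
      -- T = KᴴG T = 0, and a vector in the range of G killed by Gᴴ is zero.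
      have hKT : -(Rᴴ * M) * T =
          Rᴴ * Ψ * (-((2 : ℂ) • (L.map star - Complex.I • h)) * T) := by
        rw [hM]; simp [Matrix.mul_assoc]
      have e1 : (Rᴴ * Ψ)ᴴ * (-(Rᴴ * M) * T) = 0 := by
        have e2 : (Rᴴ * Ψ)ᴴ * -(Rᴴ * M) = (-(Rᴴ * M))ᴴ * (Rᴴ * Ψ) := by
          have e3 : (Rᴴ * Ψ)ᴴ * -(Rᴴ * M) = -(Ψᴴ * Xt * M) := by
            rw [hRR]; simp [Matrix.mul_assoc]
          rw [e3, ← hst.eq, ← conjTranspose_neg, ← e3]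
          simp
        rw [← Matrix.mul_assoc, e2, Matrix.mul_assoc, hT, Matrix.mul_zero]
      rw [hKT] at e1 ⊢
      rw [← Matrix.mul_assoc] at e1
      exact (conjTranspose_mul_self_mul_eq_zero _ _).mp e1)
  have hBρ : B * (Rᴴ * Cᵀ * R) = -(Rᴴ * (M * Ψᴴ) * R) := by
    have : B * (Rᴴ * Cᵀ * R) = B * (Rᴴ * Ψ) * (Ψᴴ * R) := by
      rw [← hΨ]; simp only [Matrix.mul_assoc]
    rw [this, hBG]
    simp only [Matrix.mul_assoc, Matrix.neg_mul]
  have hρB : Rᴴ * Cᵀ * R * B = -(Rᴴ * (Ψ * Mᴴ) * R) := by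
    have h1 := congrArg conjTranspose hBρ
    have hC : Cᵀᴴ = Cᵀ := by rw [← hΨ]; simp
    simpa [hB.eq, hC, Matrix.mul_assoc] using h1
  refine ⟨d, vecMulVec (fun p : IOIndex N a b × Fin d => R p.1 p.2)
      (star fun p : IOIndex N a b × Fin d => R p.1 p.2), Bᵀ, ?_, hB.transpose, ?_, ?_⟩
  · rw [isStrategy_iff, traceF_vecMulVec, ← hRR]
    exact ⟨posSemidef_vecMulVec_self_star _, htr, hfix⟩
  -- The output states are transposes of RᴴCᵀR, which is why the score operator is Bᵀ and the
  -- equation is checked transposed.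
  · apply transpose_injective
    rw [transpose_smul, transpose_add, transpose_mul, transpose_mul, transpose_transpose,
      linkProd_vecMulVec_transpose, linkProd_vecMulVec_transpose, hBρ, hρB]
    have e : -(Rᴴ * (M * Ψᴴ) * R) + -(Rᴴ * (Ψ * Mᴴ) * R) = -(Rᴴ * (M * Ψᴴ + Ψ * Mᴴ) * R) := by
      rw [Matrix.mul_add, Matrix.add_mul]; abel
    rw [e, hadd, transpose_neg, Matrix.mul_smul, Matrix.smul_mul, Matrix.mul_neg, Matrix.neg_mul]
    module
  · congr 1
    rw [← trace_transpose, transpose_mul, transpose_mul, transpose_transpose,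
      linkProd_vecMulVec_transpose, Matrix.mul_assoc, hBρ, hRR, Matrix.mul_neg, trace_neg]
    have e : B * (Rᴴ * (M * Ψᴴ) * R) = B * (Rᴴ * M * (Ψᴴ * R)) := by
      simp only [Matrix.mul_assoc]
    have e2 : (Ψᴴ * R) * B = -(Mᴴ * R) := by
      have h1 := congrArg conjTranspose hBG
      simpa [hB.eq, Matrix.mul_assoc] using h1
    rw [e, ← Matrix.mul_assoc, trace_mul_comm, ← Matrix.mul_assoc, e2, Matrix.neg_mul, trace_neg,
      neg_neg, trace_mul_comm]
    simp only [Matrix.mul_assoc]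
    rw [trace_mul_comm, trace_mul_comm R]
    simp only [Matrix.mul_assoc]
    rw [trace_mul_comm Rᴴ]
    simp only [Matrix.mul_assoc]

end Attainment

theorem mainTheorem4 {a b : Type*} [Fintype a] [DecidableEq a] [Nonempty a]
    [Fintype b] [DecidableEq b] [Nonempty b]
    (k : StrategyType) (N : ℕ)
    (μ : Measure ℝ) [IsProbabilityMeasure μ] (hμ : Integrable (fun θ : ℝ => θ) μ)
    (E : ℝ → (Matrix a a ℂ →ₗ[ℂ] Matrix b b ℂ)) (hE : ∀ θ, IsChannel (E θ))
    (hEmeas : ∀ (ρ : Matrix a a ℂ) (x y : b), Measurable fun θ => E θ ρ x y)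
    (q : ℕ) (Φ : Matrix (IOIndex N a b) (Fin q) ℂ) (hΦ : Φ * Φᴴ = meanChoi N μ E)
    (H : IOMatrix N a b) (hH : H.IsHermitian)
    (hHC : -(H * meanChoi N μ E + meanChoi N μ E * H) = momentChoi N μ E) :
    IsGreatest (informationValues k N μ E) (Jmax k N μ E) ∧
      IsLeast (dualValues k H Φ) (Jmax k N μ E) := by
  have hmean : ∀ {d : ℕ} (X : Matrix (IOIndex N a b × Fin d) (IOIndex N a b × Fin d) ℂ),
      meanMatrix μ (fun θ => linkProd X (choiN N E θ)) = linkProd X (meanChoi N μ E) := fun X =>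
    meanMatrix_linkProd X (integrable_choiN hE hEmeas)
  have hmoment : ∀ {d : ℕ} (X : Matrix (IOIndex N a b × Fin d) (IOIndex N a b × Fin d) ℂ),
      meanMatrix μ (fun θ => (θ : ℂ) • linkProd X (choiN N E θ)) =
        linkProd X (momentChoi N μ E) := fun X => by
    simp only [← linkProd_smul]
    exact meanMatrix_linkProd X (integrable_smul_choiN hμ hE hEmeas)
  have hweak : ∀ J ∈ informationValues k N μ E, ∀ l ∈ dualValues k H Φ, J ≤ l := by
    rintro _ ⟨d, X, S, hX, hS, hSLD, rfl⟩ l ⟨h, Y, hd⟩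
    rw [hmean, hmoment] at hSLD
    rw [hmean]
    exact information_le_of_dualFeasible hH hΦ hHC hd hX hS hSLD
  obtain ⟨h, l, Y, Xt, hd, hXt, htr, hfix, hval, hst⟩ := exists_dual_optimum k H Φ
  obtain ⟨d, X, S, hX, hS, hSLD, hJ⟩ := exists_strategy_of_dual_optimum hH hΦ hHC
    (fun T hT => momentChoi_mul_eq_zero hμ hE hEmeas hT) hd.1 hXt htr hfix hst
  have hl : l ∈ dualValues k H Φ := ⟨h, Y, hd⟩
  -- The same number is attained by a strategy and by a dual feasible point, so weak duality makes
  -- it extremal on both sides.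
  have hmem : l ∈ informationValues k N μ E :=
    ⟨d, X, S, hX, hS, by rw [hmean, hmoment]; exact hSLD, by rw [hmean, hJ, hval]⟩
  have hgreatest : IsGreatest (informationValues k N μ E) l := ⟨hmem, fun J hJ => hweak J hJ l hl⟩
  have hJmax : Jmax k N μ E = l := hgreatest.csSup_eq
  rw [hJmax]
  exact ⟨hgreatest, hl, fun l' hl' => hweak l hmem l' hl'⟩
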